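/- **Theorem (Acyclic calculus).** Let $X$ be a smooth complex algebraic variety (a smooth, separated scheme of finite type over $\mathbb C$), and let $\overline{V}^b(X)$ be the category whose objects $\overline E=(E,h)$ are bounded cochain complexes $E$ of algebraic vector bundles on $X$ with a $C^\infty$ hermitian metric $h$ on each term of $E^{\mathrm{an}}$, and whose morphisms are all morphisms of the underlying complexes. Acyclicity and quasi-isomorphisms refer to the underlying complexes of $\mathcal O_X$-modules; $\oplus$ is the orthogonal direct sum, and $\overline E[1]$ is the shift ($E[1]^n=E^{n+1}$, differential $-\mathrm d$). For $f\colon\overline E\to\overline F$ let $\overline{\mathrm{cone}}(f)$ (also written $\overline{\mathrm{cone}}(\overline E,\overline F)$) be $E[1]\oplus F$ with differential $\mathrm d(x,y)=(-\mathrm dx,f(x)+\mathrm dy)$ and the orthogonal sum metric. The class $\mathscr M$ of *meager* complexes is the smallest class of objects that contains (a) the orthogonally split complexes, i.e. those for which there are hermitian vector bundles $\overline A^n$ with each $\overline E^n$ the orthogonal sum $\overline A^n\oplus\overline A^{n+1}$ and $\mathrm d\colon E^n\to E^{n+1}$ the projection to $A^{n+1}$ followed by the inclusion, and (b) all complexes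 isometric to $\overline F\oplus\overline F[1]$ with $\overline F$ acyclic, and such that (c) for every morphism $f\colon\overline E\to\overline F$, if two of $\overline E,\overline F,\overline{\mathrm{cone}}(f)$ are in $\mathscr M$, so is the third. A morphism $f$ is *tight* if $\overline{\mathrm{cone}}(f)$ is meager; $\overline E$ and $\overline F$ are *tightly related* if there are an object $\overline G$ and tight morphisms $\overline E\leftarrow\overline G\to\overline F$. This is an equivalence relation; let $\overline V^b(X)/\mathscr M$ be the set of classes and $[\overline E]$ the class of $\overline E$. Then: 1. $[\overline E]=0$ (the class of the zero complex) if and only if $\overline E\in\mathscr M$. 2. The operation $\oplus$ induces an operation $+$ on $\overline V^b(X)/\mathscr M$, which makes it an associative abelian semigroup with neutral element $0$. 3. For a complex $\overline E$ there exists $\overline F$ with $[\overline F]+[\overline E]=0$ if and only if $\overline E$ is acyclic. In this case $[\overline E[1]]=-[\overline E]$. 4. For every morphism $f\colon\overline E\to\overline F$ with $\overline E$ acyclic, $[\overline{\mathrm{cone}}(f)]=[\overline F]-[\overline E]$. 5. For every morphism $f\colon\overline E\to\overline F$ with $\overline F$ acyclic, $[\overline{\mathrm{cone}}(f)]=[\overline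 F]+[\overline E[1]]$. 6. Let $f'\colon\overline E'\to\overline F'$, $f\colon\overline E\to\overline F$, $g'\colon\overline E'\to\overline E$, $g\colon\overline F'\to\overline F$ be morphisms and $h$ any homotopy $gf'-fg'=\mathrm dh+h\mathrm d$. Let $\psi\colon\overline{\mathrm{cone}}(f')\to\overline{\mathrm{cone}}(f)$, $\psi(x',y')=(g'(x'),g(y')+h(x'))$, and $\phi\colon\overline{\mathrm{cone}}(-g')\to\overline{\mathrm{cone}}(g)$, $\phi(x',x)=(-f'(x'),f(x)+h(x'))$, be the induced morphisms. Then $[\overline{\mathrm{cone}}(\psi)]=[\overline{\mathrm{cone}}(\phi)]$. 7. Let $f\colon\overline E\to\overline F$ and $g\colon\overline F\to\overline G$ be morphisms. With the natural morphisms $\overline{\mathrm{cone}}(g\circ f)\to\overline{\mathrm{cone}}(g)$, $(x,z)\mapsto(f(x),z)$, and $\overline{\mathrm{cone}}(f)\to\overline{\mathrm{cone}}(g\circ f)$, $(x,y)\mapsto(x,g(y))$, $$[\overline{\mathrm{cone}}(\overline{\mathrm{cone}}(g\circ f),\overline{\mathrm{cone}}(g))]=[\overline{\mathrm{cone}}(f)[1]],\qquad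 [\overline{\mathrm{cone}}(\overline{\mathrm{cone}}(f),\overline{\mathrm{cone}}(g\circ f))]=[\overline{\mathrm{cone}}(g)].$$ If $f$ or $g$ is a quasi-isomorphism, then $[\overline{\mathrm{cone}}(g\circ f)]=[\overline{\mathrm{cone}}(g)]+[\overline{\mathrm{cone}}(f)]$. If $g\circ f$ is a quasi-isomorphism, then $[\overline{\mathrm{cone}}(g)]=[\overline{\mathrm{cone}}(f)[1]]+[\overline{\mathrm{cone}}(g\circ f)]$. -/

import Mathlib

open CategoryTheory Limits AlgebraicGeometry
open scoped ContDiff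

noncomputable section

namespace AcyclicCalculus

variable {X : Scheme.{0}} {s : X ⟶ Spec (.of ℂ)}

/-! ### Complex points, fibres and smooth functions -/

/-- A complex point of the `ℂ`-scheme `s : X ⟶ Spec ℂ`, i.e. a point of the analytification. -/
structure CPoint (s : X ⟶ Spec (.of ℂ)) where
  hom : Spec (.of ℂ) ⟶ X
  comp : hom ≫ s = 𝟙 _

/-- The complex point `x` lies in the Zariski open subset `U`. -/
def CPoint.Mem (x : CPoint s) (U : X.Opens) : Prop := ⊤ ≤ x.hom ⁻¹ᵁ U

lemma CPoint.Mem.mono {x : CPoint s} {V U : X.Opens} (h : x.Mem V) (hVU : V ≤ U) : x.Mem U :=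
  h.trans (fun _ hy => hVU hy)

/-- The value `g(x) ∈ ℂ` of a regular function `g ∈ 𝒪_X(U)` at a complex point `x` of `U`. -/
def CPoint.val (x : CPoint s) (U : X.Opens) (hx : x.Mem U) : Γ(X, U) →+* ℂ :=
  (x.hom.appLE U ⊤ hx ≫ (Scheme.ΓSpecIso (.of ℂ)).hom).hom

/-- The fibre functor `E ↦ E(x) = Γ(Spec ℂ, x^* E)` at a complex point `x`. -/
def fiber (x : CPoint s) : X.Modules ⥤ ModuleCat.{0} ℂ :=
  Scheme.Modules.pullback x.hom ⋙ moduleSpecΓFunctor (R := CommRingCat.of ℂ)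

/-- The value `t(x) ∈ E(x)` of a section `t ∈ E(U)` at a complex point `x` of `U`. -/
def ev (x : CPoint s) (E : X.Modules) (U : X.Opens) (hx : x.Mem U) :
    Γ(E, U) →+ (fiber x).obj E :=
  ((((Scheme.Modules.pullbackPushforwardAdjunction x.hom).unit.app E).app U) ≫
    ((Scheme.Modules.pullback x.hom).obj E).presheaf.map (homOfLE hx).op).hom

/-- `C^∞` functions on (the analytification of) a Zariski open subset `U` of `X`.
The sets `{y ∈ V(ℂ) | (g₁(y), …, g_m(y)) ∈ W}`, with `V ⊆ U` Zariski open, `g_i ∈ 𝒪_X(V)` and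
`W ⊆ ℂ^m` open, form a basis of the analytic topology of `U(ℂ)`, and `V^an` is locally embedded
in `ℂ^m` by regular functions. So a function is `C^∞` on the complex manifold `U^an` iff near every
point, in the analytic topology, it is a `C^∞` function (over `ℝ`) of finitely many regular
functions. -/
def IsSmoothFunction (U : X.Opens) (φ : ∀ x : CPoint s, x.Mem U → ℂ) : Prop :=
  ∀ (x : CPoint s), x.Mem U →
    ∃ (V : X.Opens) (hVU : V ≤ U) (hxV : x.Mem V) (ι : Type) (_ : Fintype ι)
      (g : ι → Γ(X, V)) (W : Set (ι → ℂ)) (F : (ι → ℂ) → ℂ),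
      IsOpen W ∧ ContDiffOn ℝ ∞ F W ∧ (fun i => x.val V hxV (g i)) ∈ W ∧
        ∀ (y : CPoint s) (hy : y.Mem V), (fun i => y.val V hy (g i)) ∈ W →
          φ y (hy.mono hVU) = F (fun i => y.val V hy (g i))

/-! ### Vector bundles and hermitian metrics -/

/-- Algebraic vector bundles: locally free `𝒪_X`-modules of finite (locally constant) rank. Locally
there are sections `e_1, …, e_n` over `U` inducing an isomorphism `𝒪_U^n ≅ E|_U`. -/
def IsVectorBundle (E : X.Modules) : Prop :=
  ∀ x : X, ∃ (U : X.Opens) (n : ℕ) (e : Fin n → Γ(E, U)), x ∈ U ∧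
    ∀ (V : X.Opens) (hV : V ≤ U),
      Function.Bijective (fun c : Fin n → Γ(X, V) =>
        ∑ i, c i • E.presheaf.map (homOfLE hV).op (e i))

/-- A `C^∞` hermitian metric on the analytic vector bundle associated with `E`: a hermitian inner
product on each fibre, such that the inner product of any two local algebraic sections is a
`C^∞` function. (Algebraic local frames are frames of `E^an`.) -/
structure HermMetric (s : X ⟶ Spec (.of ℂ)) (E : X.Modules) where
  core : ∀ x : CPoint s, InnerProductSpace.Core ℂ ((fiber x).obj E)
  smooth : ∀ (U : X.Opens) (t t' : Γ(E, U)),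
    IsSmoothFunction U (fun x hx => (core x).inner (ev x E U hx t) (ev x E U hx t'))

/-- A hermitian vector bundle on `X`. -/
structure HermBundle (s : X ⟶ Spec (.of ℂ)) where
  obj : X.Modules
  isVectorBundle : IsVectorBundle obj
  metric : HermMetric s obj

/-- `p : A ⟶ B` and `q : A ⟶ C` exhibit `A`, with its metric, as the orthogonal direct sum
of `B` and `C`. -/
def IsOrthogonalSum {A B C : X.Modules} (hA : HermMetric s A) (hB : HermMetric s B)
    (hC : HermMetric s C) (p : A ⟶ B) (q : A ⟶ C) : Prop :=
  IsIso (biprod.lift p q) ∧ ∀ (x : CPoint s) (v w : (fiber x).obj A),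
    (hA.core x).inner v w =
      (hB.core x).inner ((fiber x).map p v) ((fiber x).map p w) +
      (hC.core x).inner ((fiber x).map q v) ((fiber x).map q w)

/-! Helper facts: orthogonal sums exist. -/

instance (x : CPoint s) : (fiber x).Additive where
  map_add {E F f g} := by
    ext v
    have : (Scheme.Modules.pullback x.hom).map (f + g) =
        (Scheme.Modules.pullback x.hom).map f + (Scheme.Modules.pullback x.hom).map g :=
      Functor.map_add _
    exact congrArg (fun φ => (Scheme.Modules.Hom.app φ ⊤) v) this

lemma ev_map (x : CPoint s) {E F : X.Modules} (φ : E ⟶ F) (U : X.Opens) (hx : x.Mem U)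
    (t : Γ(E, U)) : ev x F U hx (φ.app U t) = (fiber x).map φ (ev x E U hx t) := by
  have h1 := (Scheme.Modules.pullbackPushforwardAdjunction x.hom).unit.naturality φ
  have h2 := congrArg (fun ψ => (Scheme.Modules.Hom.app ψ U) t) h1
  have h3 := ((Scheme.Modules.pullback x.hom).map φ).mapPresheaf.naturality (homOfLE hx).op
  have h4 := congrArg (fun ψ => ψ ((Scheme.Modules.Hom.app
    ((Scheme.Modules.pullbackPushforwardAdjunction x.hom).unit.app E) U) t)) h3
  exact Eq.trans (congrArg (((Scheme.Modules.pullback x.hom).obj F).presheaf.map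
    (homOfLE hx).op) h2) h4.symm

lemma CPoint.Mem.inf {x : CPoint s} {V U : X.Opens} (h : x.Mem V) (h' : x.Mem U) :
    x.Mem (V ⊓ U) := fun _ hy => ⟨h hy, h' hy⟩

lemma CPoint.val_map (x : CPoint s) {V U : X.Opens} (hVU : V ≤ U) (h : x.Mem V) (g : Γ(X, U)) :
    x.val V h (X.presheaf.map (homOfLE hVU).op g) = x.val U (h.mono hVU) g := by
  have := x.hom.map_appLE (V := ⊤) h (homOfLE hVU).op
  exact congrArg (fun ψ => (Scheme.ΓSpecIso (.of ℂ)).hom (ψ g)) this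

lemma IsSmoothFunction.add {U : X.Opens} {φ ψ : ∀ x : CPoint s, x.Mem U → ℂ}
    (hφ : IsSmoothFunction U φ) (hψ : IsSmoothFunction U ψ) :
    IsSmoothFunction U (fun x hx => φ x hx + ψ x hx) := by
  intro x hx
  obtain ⟨V, hVU, hxV, ι, _, g, W, F, hW, hF, hxW, h⟩ := hφ x hx
  obtain ⟨V', hVU', hxV', κ, _, g', W', F', hW', hF', hxW', h'⟩ := hψ x hx
  let a : (ι ⊕ κ → ℂ) →L[ℝ] (ι → ℂ) := ContinuousLinearMap.pi fun i =>
    ContinuousLinearMap.proj (R := ℝ) (φ := fun _ : ι ⊕ κ => ℂ) (Sum.inl i)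
  let b : (ι ⊕ κ → ℂ) →L[ℝ] (κ → ℂ) := ContinuousLinearMap.pi fun i =>
    ContinuousLinearMap.proj (R := ℝ) (φ := fun _ : ι ⊕ κ => ℂ) (Sum.inr i)
  let G : ι ⊕ κ → Γ(X, V ⊓ V') := Sum.elim
    (fun i => X.presheaf.map (homOfLE inf_le_left).op (g i))
    (fun i => X.presheaf.map (homOfLE inf_le_right).op (g' i))
  have ha : ∀ (y : CPoint s) (hy : y.Mem (V ⊓ V')),
      a (fun i => y.val _ hy (G i)) = fun i => y.val V (hy.mono inf_le_left) (g i) :=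
    fun y hy => funext fun i => y.val_map inf_le_left hy (g i)
  have hb : ∀ (y : CPoint s) (hy : y.Mem (V ⊓ V')),
      b (fun i => y.val _ hy (G i)) = fun i => y.val V' (hy.mono inf_le_right) (g' i) :=
    fun y hy => funext fun i => y.val_map inf_le_right hy (g' i)
  refine ⟨V ⊓ V', inf_le_left.trans hVU, hxV.inf hxV', ι ⊕ κ, inferInstance, G,
    a ⁻¹' W ∩ b ⁻¹' W', fun z => F (a z) + F' (b z),
    (hW.preimage a.continuous).inter (hW'.preimage b.continuous),
    (hF.comp a.contDiff.contDiffOn fun z hz => hz.1).add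
      (hF'.comp b.contDiff.contDiffOn fun z hz => hz.2), ⟨?_, ?_⟩, ?_⟩
  · rw [Set.mem_preimage, ha]; exact hxW
  · rw [Set.mem_preimage, hb]; exact hxW'
  · rintro y hy ⟨h1, h2⟩
    rw [Set.mem_preimage, ha] at h1
    rw [Set.mem_preimage, hb] at h2
    simp only [ha, hb]
    rw [← h y (hy.mono inf_le_left) h1, ← h' y (hy.mono inf_le_right) h2]

lemma IsVectorBundle.of_isZero {A : X.Modules} (hA : IsZero A) : IsVectorBundle A := by
  have hsub : ∀ V : X.Opens, Subsingleton Γ(A, V) := fun V => by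
    have h0 : ∀ t : Γ(A, V), t = 0 := fun t => by
      have := congrArg (fun ψ => (Scheme.Modules.Hom.app ψ V) t) (hA.eq_of_src (𝟙 A) 0)
      simpa using this
    exact ⟨fun t t' => (h0 t).trans (h0 t').symm⟩
  intro x
  refine ⟨⊤, 0, fun i => i.elim0, trivial, fun V hV => ⟨fun c c' _ => Subsingleton.elim _ _,
    fun t => ⟨fun i => i.elim0, ?_⟩⟩⟩
  have := hsub V
  exact Subsingleton.elim _ _

lemma IsVectorBundle.of_iso_biprod {A B C : X.Modules} (p : A ⟶ B) (q : A ⟶ C)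
    (hpq : IsIso (biprod.lift p q)) (hB : IsVectorBundle B) (hC : IsVectorBundle C) :
    IsVectorBundle A := by
  let i : B ⟶ A := biprod.inl ≫ inv (biprod.lift p q)
  let j : C ⟶ A := biprod.inr ≫ inv (biprod.lift p q)
  have e1 : biprod.lift p q ≫ biprod.fst = p := biprod.lift_fst p q
  have e2 : biprod.lift p q ≫ biprod.snd = q := biprod.lift_snd p q
  have hip : i ≫ p = 𝟙 B := by rw [← e1]; simp only [i, Category.assoc,
    IsIso.inv_hom_id_assoc, biprod.inl_fst]
  have hiq : i ≫ q = 0 := by rw [← e2]; simp only [i, Category.assoc,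
    IsIso.inv_hom_id_assoc, biprod.inl_snd]
  have hjq : j ≫ q = 𝟙 C := by rw [← e2]; simp only [j, Category.assoc,
    IsIso.inv_hom_id_assoc, biprod.inr_snd]
  have hjp : j ≫ p = 0 := by rw [← e1]; simp only [j, Category.assoc,
    IsIso.inv_hom_id_assoc, biprod.inr_fst]
  have htot : p ≫ i + q ≫ j = 𝟙 A := by
    have : biprod.lift p q = p ≫ biprod.inl + q ≫ biprod.inr := biprod.lift_eq
    simp only [i, j]
    rw [← Category.assoc, ← Category.assoc, ← Preadditive.add_comp, ← this, IsIso.hom_inv_id]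
  intro x
  obtain ⟨U, n, e, hxU, he⟩ := hB x
  obtain ⟨U', m, e', hxU', he'⟩ := hC x
  refine ⟨U ⊓ U', n + m, Fin.append
    (fun k => A.presheaf.map (homOfLE inf_le_left).op (i.app U (e k)))
    (fun k => A.presheaf.map (homOfLE inf_le_right).op (j.app U' (e' k))),
    ⟨hxU, hxU'⟩, fun V hV => ?_⟩
  have hVU : V ≤ U := hV.trans inf_le_left
  have hVU' : V ≤ U' := hV.trans inf_le_right
  have key : ∀ c : Fin (n + m) → Γ(X, V),
      (∑ k, c k • A.presheaf.map (homOfLE hV).op ((Fin.append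
        (fun k => A.presheaf.map (homOfLE inf_le_left).op (i.app U (e k)))
        (fun k => A.presheaf.map (homOfLE inf_le_right).op (j.app U' (e' k)))) k)) =
      i.app V (∑ k, c (Fin.castAdd m k) • B.presheaf.map (homOfLE hVU).op (e k)) +
      j.app V (∑ k, c (Fin.natAdd n k) • C.presheaf.map (homOfLE hVU').op (e' k)) := by
    intro c
    rw [Fin.sum_univ_add, map_sum, map_sum]
    congr 1
    · refine Finset.sum_congr rfl fun k _ => ?_
      rw [Scheme.Modules.Hom.app_smul, Fin.append_left]
      congr 1
      have h1 := congrArg (fun ψ => ψ (e k)) (i.mapPresheaf.naturality (homOfLE hVU).op)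
      refine Eq.trans ?_ h1.symm
      exact (congrArg (fun ψ => ψ (i.app U (e k)))
        (A.presheaf.map_comp (homOfLE inf_le_left).op (homOfLE hV).op)).symm
    · refine Finset.sum_congr rfl fun k _ => ?_
      rw [Scheme.Modules.Hom.app_smul, Fin.append_right]
      congr 1
      have h1 := congrArg (fun ψ => ψ (e' k)) (j.mapPresheaf.naturality (homOfLE hVU').op)
      refine Eq.trans ?_ h1.symm
      exact (congrArg (fun ψ => ψ (j.app U' (e' k)))
        (A.presheaf.map_comp (homOfLE inf_le_right).op (homOfLE hV).op)).symm
  have appc : ∀ {P Q R : X.Modules} (φ : P ⟶ Q) (ψ : Q ⟶ R) (t : Γ(P, V)),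
      ψ.app V (φ.app V t) = (φ ≫ ψ).app V t := fun φ ψ t => rfl
  constructor
  · intro c c' hcc
    simp only [key] at hcc
    have hp := congrArg (p.app V) hcc
    have hq := congrArg (q.app V) hcc
    simp only [map_add, appc, hip, hiq, hjp, hjq] at hp hq
    have hp' := (he V hVU).1 (by simpa using hp)
    have hq' := (he' V hVU').1 (by simpa using hq)
    funext k
    refine Fin.addCases (fun k => congrFun hp' k) (fun k => congrFun hq' k) k
  · intro t
    obtain ⟨c, hc⟩ := (he V hVU).2 (p.app V t)
    obtain ⟨c', hc'⟩ := (he' V hVU').2 (q.app V t)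
    refine ⟨Fin.append c c', ?_⟩
    simp only [key, Fin.append_left, Fin.append_right]
    have := congrArg (fun ψ => (Scheme.Modules.Hom.app ψ V) t) htot
    refine Eq.trans ?_ this
    change i.app V ((fun c => ∑ k, c k • B.presheaf.map (homOfLE hVU).op (e k)) c) +
      j.app V ((fun c' => ∑ k, c' k • C.presheaf.map (homOfLE hVU').op (e' k)) c') = _
    rw [hc, hc']
    rfl

/-- The metric on `A` making it the orthogonal sum of `B` and `C` along `p` and `q`. -/
def HermMetric.orthogonalSum {A B C : X.Modules} (hB : HermMetric s B) (hC : HermMetric s C)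
    (p : A ⟶ B) (q : A ⟶ C) (hpq : IsIso (biprod.lift p q)) : HermMetric s A where
  core x :=
    { inner := fun v w =>
        (hB.core x).inner ((fiber x).map p v) ((fiber x).map p w) +
        (hC.core x).inner ((fiber x).map q v) ((fiber x).map q w)
      conj_inner_symm := fun v w => by
        rw [map_add, (hB.core x).conj_inner_symm, (hC.core x).conj_inner_symm]
      re_inner_nonneg := fun v => by
        rw [map_add]
        exact add_nonneg ((hB.core x).re_inner_nonneg _) ((hC.core x).re_inner_nonneg _)
      add_left := fun u v w => by
        rw [map_add, map_add, (hB.core x).add_left, (hC.core x).add_left]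
        ring
      smul_left := fun v w r => by
        rw [map_smul, map_smul, (hB.core x).smul_left, (hC.core x).smul_left]
        ring
      definite := fun v hv => by
        have him : ∀ {H : ModuleCat.{0} ℂ} (h : InnerProductSpace.Core ℂ H) (u : H),
            (h.inner u u).im = 0 := fun h u =>
          Complex.conj_eq_iff_im.mp (h.conj_inner_symm u u)
        have h1 : 0 ≤ ((hB.core x).inner ((fiber x).map p v) ((fiber x).map p v)).re :=
          (hB.core x).re_inner_nonneg _
        have h2 : 0 ≤ ((hC.core x).inner ((fiber x).map q v) ((fiber x).map q v)).re :=
          (hC.core x).re_inner_nonneg _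
        have h3 := congrArg Complex.re hv
        rw [Complex.add_re, Complex.zero_re] at h3
        have hp : (fiber x).map p v = 0 := (hB.core x).definite _
          (Complex.ext (by rw [Complex.zero_re]; linarith) (him _ _))
        have hq : (fiber x).map q v = 0 := (hC.core x).definite _
          (Complex.ext (by rw [Complex.zero_re]; linarith) (him _ _))
        have hl : biprod.lift p q = p ≫ biprod.inl + q ≫ biprod.inr :=
          biprod.lift_eq
        have h4 : (fiber x).map (biprod.lift p q) v = 0 := by
          rw [hl, Functor.map_add, Functor.map_comp, Functor.map_comp]
          simp [hp, hq]
        have h5 : (fiber x).map (𝟙 A) v = 0 := by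
          rw [← IsIso.hom_inv_id (biprod.lift p q), Functor.map_comp]
          exact (congrArg ((fiber x).map (inv (biprod.lift p q))) h4).trans (map_zero _)
        simpa using h5 }
  smooth U t t' := by
    have := (hB.smooth U (p.app U t) (p.app U t')).add (hC.smooth U (q.app U t) (q.app U t'))
    simp only [ev_map] at this
    exact this

/-- The metric on a zero bundle. -/
def HermMetric.ofIsZero {A : X.Modules} (hA : IsZero A) : HermMetric s A where
  core x :=
    { inner := fun _ _ => 0
      conj_inner_symm := fun _ _ => map_zero _
      re_inner_nonneg := fun _ => by simp
      add_left := fun _ _ _ => by simp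
      smul_left := fun _ _ _ => by simp
      definite := fun v _ => by
        have h : (fiber x).map (𝟙 A) v = (fiber x).map (0 : A ⟶ A) v := by
          rw [hA.eq_of_src (𝟙 A) 0]
        simpa using h }
  smooth U t t' := fun x hx => ⟨U, le_rfl, hx, Empty, inferInstance, fun i => i.elim, Set.univ,
    fun _ => 0, isOpen_univ, contDiffOn_const, trivial, fun _ _ _ => rfl⟩

/-! ### Bounded complexes of hermitian vector bundles -/

/-- Objects of `V̄^b(X)`: bounded cochain complexes of vector bundles with a hermitian metric on
each term. Morphisms `E ⟶ F` are the morphisms `E.cx ⟶ F.cx` of the underlying complexes, and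
acyclicity and quasi-isomorphisms are those of complexes of `𝒪_X`-modules. -/
structure HermComplex (s : X ⟶ Spec (.of ℂ)) where
  cx : CochainComplex X.Modules ℤ
  bounded : ∃ N : ℤ, ∀ n : ℤ, N < |n| → IsZero (cx.X n)
  isVectorBundle : ∀ n, IsVectorBundle (cx.X n)
  metric : ∀ n, HermMetric s (cx.X n)

namespace HermComplex

/-- The zero complex. -/
def zero (s : X ⟶ Spec (.of ℂ)) : HermComplex s :=
  have h : ∀ n : ℤ, IsZero ((HomologicalComplex.zero :
      CochainComplex X.Modules ℤ).X n) := fun _ => isZero_zero _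
  { cx := HomologicalComplex.zero
    bounded := ⟨0, fun n _ => h n⟩
    isVectorBundle := fun n => .of_isZero (h n)
    metric := fun n => .ofIsZero (h n) }

/-- The shift `E[1]`: `E[1]^n = E^{n+1}` with differential `-d`. -/
def shift (E : HermComplex s) : HermComplex s where
  cx := E.cx⟦(1 : ℤ)⟧
  bounded := by
    obtain ⟨N, hN⟩ := E.bounded
    refine ⟨N + 1, fun n hn => hN (n + 1) ?_⟩
    rcases abs_cases n with h | h <;> rcases abs_cases (n + 1) with h' | h' <;> lia
  isVectorBundle n := E.isVectorBundle (n + 1)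
  metric n := E.metric (n + 1)

lemma isIso_dsum (K L : CochainComplex X.Modules ℤ) (n : ℤ) :
    IsIso (biprod.lift ((biprod.fst : K ⊞ L ⟶ K).f n) ((biprod.snd : K ⊞ L ⟶ L).f n)) := by
  refine ⟨biprod.desc ((biprod.inl : K ⟶ K ⊞ L).f n) ((biprod.inr : L ⟶ K ⊞ L).f n), ?_, ?_⟩
  · rw [biprod.lift_desc, ← HomologicalComplex.comp_f, ← HomologicalComplex.comp_f,
      ← HomologicalComplex.add_f_apply, biprod.total, HomologicalComplex.id_f]
  · apply biprod.hom_ext <;> apply biprod.hom_ext' <;> simp [← HomologicalComplex.comp_f]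

/-- The orthogonal direct sum `E ⊕ F`. -/
def dsum (E F : HermComplex s) : HermComplex s where
  cx := E.cx ⊞ F.cx
  bounded := by
    obtain ⟨N, hN⟩ := E.bounded
    obtain ⟨M, hM⟩ := F.bounded
    refine ⟨max N M, fun n hn => ?_⟩
    have := isIso_dsum E.cx F.cx n
    refine IsZero.of_iso ((biprod_isZero_iff _ _).mpr
      ⟨hN n (lt_of_le_of_lt (le_max_left _ _) hn), hM n (lt_of_le_of_lt (le_max_right _ _) hn)⟩)
      (asIso (biprod.lift ((biprod.fst : E.cx ⊞ F.cx ⟶ E.cx).f n)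
        ((biprod.snd : E.cx ⊞ F.cx ⟶ F.cx).f n)))
  isVectorBundle n := .of_iso_biprod _ _ (isIso_dsum E.cx F.cx n)
    (E.isVectorBundle n) (F.isVectorBundle n)
  metric n := (E.metric n).orthogonalSum (F.metric n) _ _ (isIso_dsum E.cx F.cx n)

/-- The projection `cone(f)^n ⟶ E^{n+1}`. -/
abbrev coneFst {K L : CochainComplex X.Modules ℤ} (f : K ⟶ L) (n : ℤ) :
    (CochainComplex.mappingCone f).X n ⟶ K.X (n + 1) :=
  (CochainComplex.mappingCone.fst f).1.v n (n + 1) rfl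

/-- The projection `cone(f)^n ⟶ F^n`. -/
abbrev coneSnd {K L : CochainComplex X.Modules ℤ} (f : K ⟶ L) (n : ℤ) :
    (CochainComplex.mappingCone f).X n ⟶ L.X n :=
  (CochainComplex.mappingCone.snd f).v n n (add_zero n)

lemma isIso_cone {K L : CochainComplex X.Modules ℤ} (f : K ⟶ L) (n : ℤ) :
    IsIso (biprod.lift (coneFst f n) (coneSnd f n)) := by
  refine ⟨biprod.desc ((CochainComplex.mappingCone.inl f).v (n + 1) n (by lia))
    ((CochainComplex.mappingCone.inr f).f n), ?_, ?_⟩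
  · rw [biprod.lift_desc]
    simp [CochainComplex.mappingCone.ext_from_iff f (n + 1) n rfl]
  · apply biprod.hom_ext <;> apply biprod.hom_ext' <;> simp

/-- The hermitian cone of `f : E ⟶ F`: the cone `E[1] ⊕ F` of `f`, with differential
`d(x, y) = (-dx, f(x) + dy)` and the orthogonal sum metric. -/
def cone {E F : HermComplex s} (f : E.cx ⟶ F.cx) : HermComplex s where
  cx := CochainComplex.mappingCone f
  bounded := by
    obtain ⟨N, hN⟩ := E.bounded
    obtain ⟨M, hM⟩ := F.bounded
    refine ⟨max (N + 1) M, fun n hn => ?_⟩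
    rw [CochainComplex.mappingCone.isZero_X_iff]
    refine ⟨hN _ ?_, hM n (lt_of_le_of_lt (le_max_right _ _) hn)⟩
    have := lt_of_le_of_lt (le_max_left _ _) hn
    rcases abs_cases n with h | h <;> rcases abs_cases (n + 1) with h' | h' <;> lia
  isVectorBundle n := .of_iso_biprod _ _ (isIso_cone f n)
    (E.isVectorBundle (n + 1)) (F.isVectorBundle n)
  metric n := (E.metric (n + 1)).orthogonalSum (F.metric n) _ _ (isIso_cone f n)

/-- An isometry: an isomorphism of complexes preserving the metrics. -/
def Isometric (E F : HermComplex s) : Prop :=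
  ∃ φ : E.cx ≅ F.cx, ∀ (n : ℤ) (x : CPoint s) (v w : (fiber x).obj (E.cx.X n)),
    ((F.metric n).core x).inner ((fiber x).map (φ.hom.f n) v) ((fiber x).map (φ.hom.f n) w) =
      ((E.metric n).core x).inner v w

/-- Orthogonally split complexes: there are hermitian bundles `A^n` (the kernels of the
differentials) such that `E^n` is the orthogonal sum `A^n ⊕ A^{n+1}`, and the differential
`E^n ⟶ E^{n+1}` is the projection to `A^{n+1}` followed by the inclusion of `A^{n+1}`. -/
def OrthogonallySplit (E : HermComplex s) : Prop :=
  ∃ (A : ℤ → HermBundle s) (p : ∀ n, E.cx.X n ⟶ (A n).obj)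
    (q : ∀ n, E.cx.X n ⟶ (A (n + 1)).obj),
    ∀ n, IsOrthogonalSum (E.metric n) (A n).metric (A (n + 1)).metric (p n) (q n) ∧
      E.cx.d n (n + 1) ≫ p (n + 1) = q n ∧ E.cx.d n (n + 1) ≫ q (n + 1) = 0

/-- Meager complexes: the smallest class of objects of `V̄^b(X)` that contains the orthogonally
split complexes and the complexes isometric to `F ⊕ F[1]` with `F` acyclic, and that contains
the third of `E`, `F`, `cone(f)` whenever it contains two of them, for each `f : E ⟶ F`. -/
inductive Meager : HermComplex s → Prop
  | orthogonallySplit (E : HermComplex s) : OrthogonallySplit E → Meager E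
  | dsumShift (E F : HermComplex s) : F.cx.Acyclic → Isometric E (F.dsum F.shift) → Meager E
  | cone {E F : HermComplex s} (f : E.cx ⟶ F.cx) : Meager E → Meager F → Meager (cone f)
  | target {E F : HermComplex s} (f : E.cx ⟶ F.cx) : Meager E → Meager (HermComplex.cone f) →
      Meager F
  | source {E F : HermComplex s} (f : E.cx ⟶ F.cx) : Meager F → Meager (HermComplex.cone f) →
      Meager E

/-- A morphism is tight if its hermitian cone is meager. -/
def Tight {E F : HermComplex s} (f : E.cx ⟶ F.cx) : Prop := Meager (cone f)

/-- `E` and `F` are tightly related if there are tight morphisms `E ← G → F`. -/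
def TightlyRelated (E F : HermComplex s) : Prop :=
  ∃ (G : HermComplex s) (f : G.cx ⟶ E.cx) (g : G.cx ⟶ F.cx), Tight f ∧ Tight g

/-- The morphism `cone(f') ⟶ cone(f)`, `(x, y) ↦ (g'(x), g(y) + h(x))`, induced by a square with
a homotopy `h` between `g ∘ f'` and `f ∘ g'`, that is `g f' - f g' = d h + h d`. -/
def coneMap {E' F' E F : HermComplex s} {f' : E'.cx ⟶ F'.cx} {f : E.cx ⟶ F.cx}
    {g' : E'.cx ⟶ E.cx} {g : F'.cx ⟶ F.cx} (h : Homotopy (f' ≫ g) (g' ≫ f)) :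
    (cone f').cx ⟶ (cone f).cx :=
  CochainComplex.mappingCone.mapOfHomotopy h

/-- The same `h`, seen as a homotopy for the transposed square, with horizontal
maps `-g' : E' ⟶ E` and `g : F' ⟶ F` and vertical maps `-f' : E' ⟶ F'` and `f : E ⟶ F`. -/
def transposeHomotopy {E' F' E F : HermComplex s} {f' : E'.cx ⟶ F'.cx} {f : E.cx ⟶ F.cx}
    {g' : E'.cx ⟶ E.cx} {g : F'.cx ⟶ F.cx} (h : Homotopy (f' ≫ g) (g' ≫ f)) :
    Homotopy ((-g') ≫ f) ((-f') ≫ g) where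
  hom := h.hom
  zero := h.zero
  comm n := by
    have := h.comm n
    simp only [Preadditive.neg_comp, HomologicalComplex.neg_f_apply] at this ⊢
    rw [this]
    abel

/-- The morphism `cone(g ∘ f) ⟶ cone(g)`, `(x, z) ↦ (f(x), z)`. -/
def coneCompToCone {E F G : HermComplex s} (f : E.cx ⟶ F.cx) (g : F.cx ⟶ G.cx) :
    (cone (E := E) (F := G) (f ≫ g)).cx ⟶ (cone g).cx :=
  CochainComplex.mappingCone.map (f ≫ g) g f (𝟙 _) (by simp)

/-- The morphism `cone(f) ⟶ cone(g ∘ f)`, `(x, y) ↦ (x, g(y))`. -/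
def coneToConeComp {E F G : HermComplex s} (f : E.cx ⟶ F.cx) (g : F.cx ⟶ G.cx) :
    (cone f).cx ⟶ (cone (E := E) (F := G) (f ≫ g)).cx :=
  CochainComplex.mappingCone.map f (f ≫ g) (𝟙 _) g (by simp)

end HermComplex

/-- `V̄^b(X)/ℳ`: classes of bounded complexes of hermitian vector bundles modulo the relation of
being tightly related. -/
def TightClass (s : X ⟶ Spec (.of ℂ)) : Type 1 :=
  Quot (HermComplex.TightlyRelated (s := s))

/-- The class `[E]`. -/
def cls (E : HermComplex s) : TightClass s := Quot.mk _ E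

end AcyclicCalculus

end

open AcyclicCalculus HermComplex

/-! The main tool is the degreewise orthogonal extension `OrthExt A B C`: a short exact sequence of
complexes that splits orthogonally in each degree. The cone of its connecting morphism C ⟶ A[1] is
isometric to B[1], so two-out-of-three makes B meager as soon as A and C are
(`OrthExt.meager_middle`). The cones of a morphism of extensions again form an extension
(`OrthExt.coneOf`), which splits complicated cones into simple ones.

Two facts start the argument. Meagerness is invariant under isometry (`Meager.of_isometric`), and
the cone of an identity is meager (`meager_cone_id`): stupid truncations reduce this to zero
differentials, where the cone is orthogonally split. It follows that in an extension the inclusion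
is tight if the quotient is meager, and the projection is tight if the subcomplex is meager
(`OrthExt.tight_i`, `OrthExt.tight_p`). Most identities between classes are instances of these two
lemmas.

Tight morphisms compose, and tight morphisms E ⟶ G ⟵ F are completed to a span by desuspending the
cone of E ⊕ F ⟶ G; this gives transitivity of the relation. Meager complexes are acyclic, by
induction on their construction, and E ⊕ E[1] is meager for acyclic E, so the invertible classes are
exactly those of acyclic complexes. The formula for the cone of f with acyclic source (or target)
follows by adding to f the zero morphism E[1] ⟶ 0 (or 0 ⟶ F[1]), which makes the source (or target)
meager. The two iterated cones of a square differ by a permutation of summands. For a composition,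
each iterated cone is an extension with the cone of an identity at one end. -/

noncomputable section

namespace AcyclicCalculus

variable {X : Scheme.{0}} {s : X ⟶ Spec (.of ℂ)}

/-! ### Forms pulled back along morphisms -/

namespace HermMetric

/-- The sesquilinear forms on the fibres of `A` obtained by pulling back the metric of `B`
along `p : A ⟶ B`. -/
def pull {A B : X.Modules} (h : HermMetric s B) (p : A ⟶ B) :
    ∀ x : CPoint s, (fiber x).obj A → (fiber x).obj A → ℂ :=
  fun x v w => (h.core x).inner ((fiber x).map p v) ((fiber x).map p w)

lemma pull_id_apply {A : X.Modules} (h : HermMetric s A) (x : CPoint s) (v w : (fiber x).obj A) :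
    h.pull (𝟙 A) x v w = (h.core x).inner v w := by
  simp [pull]

lemma pull_comp_apply {A B C : X.Modules} (h : HermMetric s C) (p : A ⟶ B) (q : B ⟶ C)
    (x : CPoint s) (v w : (fiber x).obj A) :
    h.pull (p ≫ q) x v w = h.pull q x ((fiber x).map p v) ((fiber x).map p w) := by
  simp [pull]

-- The form is sesquilinear, so the two signs cancel. This is why the signs in differentials and
-- comparison maps of cones and shifts do not disturb isometries.
@[simp]
lemma pull_neg {A B : X.Modules} (h : HermMetric s B) (p : A ⟶ B) : h.pull (-p) = h.pull p := by
  funext x v w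
  let _ := h.core x
  have hn : ∀ u : (fiber x).obj A, (fiber x).map (-p) u = (-1 : ℂ) • (fiber x).map p u := by
    intro u
    rw [Functor.map_neg]
    simp
  have h1 : ∀ a b : (fiber x).obj B, (h.core x).inner ((-1 : ℂ) • a) b =
      - (h.core x).inner a b := by
    intro a b; rw [(h.core x).smul_left]; simp
  have h2 : ∀ a b : (fiber x).obj B, (h.core x).inner a ((-1 : ℂ) • b) =
      - (h.core x).inner a b := by
    intro a b
    rw [← (h.core x).conj_inner_symm, h1, map_neg, (h.core x).conj_inner_symm]
  simp only [pull, hn, h1, h2, neg_neg]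

@[simp]
lemma pull_zero {A B : X.Modules} (h : HermMetric s B) : h.pull (0 : A ⟶ B) = 0 := by
  funext x v w
  have h0 : (h.core x).inner ((0 : ℂ) • (0 : (fiber x).obj B)) 0 = 0 := by
    rw [(h.core x).smul_left]; simp
  simpa [pull] using h0

lemma pull_orthogonalSum {A B C T : X.Modules} (hB : HermMetric s B) (hC : HermMetric s C)
    (p : A ⟶ B) (q : A ⟶ C) (hpq : IsIso (biprod.lift p q)) (u : T ⟶ A) :
    (hB.orthogonalSum hC p q hpq).pull u = hB.pull (u ≫ p) + hC.pull (u ≫ q) := by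
  funext x v w
  simp only [Pi.add_apply, pull_comp_apply]
  rfl

/-- Metrics need to be compared only along one map; the identity then propagates to everything that
factors through it. -/
lemma pull_comp_congr {A B C T : X.Modules} {h : HermMetric s B} {h' : HermMetric s C}
    {p : A ⟶ B} {p' : A ⟶ C} (e : h.pull p = h'.pull p') (u : T ⟶ A) :
    h.pull (u ≫ p) = h'.pull (u ≫ p') := by
  funext x v w
  rw [pull_comp_apply, pull_comp_apply, e]

lemma pull_comp_congr₂ {A B C D T : X.Modules} {h : HermMetric s B} {h' : HermMetric s C}
    {h'' : HermMetric s D} {p : A ⟶ B} {p' : A ⟶ C} {p'' : A ⟶ D}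
    (e : h.pull p = h'.pull p' + h''.pull p'') (u : T ⟶ A) :
    h.pull (u ≫ p) = h'.pull (u ≫ p') + h''.pull (u ≫ p'') := by
  funext x v w
  simp only [Pi.add_apply, pull_comp_apply, e]

end HermMetric

namespace HermComplex

/-- An isomorphism of complexes preserving the metrics. -/
def IsIsometry (E F : HermComplex s) (φ : E.cx ≅ F.cx) : Prop :=
  ∀ n, (F.metric n).pull (φ.hom.f n) = (E.metric n).pull (𝟙 _)

lemma isometric_iff {E F : HermComplex s} : Isometric E F ↔ ∃ φ, IsIsometry E F φ := by
  refine exists_congr fun φ => forall_congr' fun n => ⟨fun h => ?_, fun h x v w => ?_⟩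
  · funext x v w
    rw [HermMetric.pull_id_apply]
    exact h x v w
  · exact (congrFun (congrFun (congrFun h x) v) w).trans (HermMetric.pull_id_apply _ _ _ _)

lemma IsIsometry.refl (E : HermComplex s) : IsIsometry E E (Iso.refl _) := fun _ => rfl

lemma IsIsometry.symm {E F : HermComplex s} {φ : E.cx ≅ F.cx} (h : IsIsometry E F φ) :
    IsIsometry F E φ.symm := fun n => by
  have := HermMetric.pull_comp_congr (h n) (φ.inv.f n)
  rw [← HomologicalComplex.comp_f, φ.inv_hom_id, Category.comp_id] at this
  exact this.symm

lemma IsIsometry.trans {E F G : HermComplex s} {φ : E.cx ≅ F.cx} {ψ : F.cx ≅ G.cx}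
    (h : IsIsometry E F φ) (h' : IsIsometry F G ψ) : IsIsometry E G (φ ≪≫ ψ) := fun n => by
  have := HermMetric.pull_comp_congr (h' n) (φ.hom.f n)
  rw [Category.comp_id, h n] at this
  exact this

lemma Isometric.refl (E : HermComplex s) : Isometric E E :=
  isometric_iff.2 ⟨_, .refl E⟩

lemma Isometric.symm {E F : HermComplex s} (h : Isometric E F) : Isometric F E :=
  let ⟨_, h⟩ := isometric_iff.1 h
  isometric_iff.2 ⟨_, h.symm⟩

lemma Isometric.trans {E F G : HermComplex s} (h : Isometric E F) (h' : Isometric F G) :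
    Isometric E G :=
  let ⟨_, h⟩ := isometric_iff.1 h
  let ⟨_, h'⟩ := isometric_iff.1 h'
  isometric_iff.2 ⟨_, h.trans h'⟩

/-! ### Components of cones, shifts and sums -/

section cone

variable {E F E' F' : HermComplex s} (f : E.cx ⟶ F.cx) (f' : E'.cx ⟶ F'.cx)

/-- The projection of a term of the cone to the source. -/
def cFst (n : ℤ) : (cone f).cx.X n ⟶ E.cx.X (n + 1) := coneFst f n

/-- The projection of a term of the cone to the target. -/
def cSnd (n : ℤ) : (cone f).cx.X n ⟶ F.cx.X n := coneSnd f n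

/-- The inclusion of a term of the source in the cone. -/
def cInl (n : ℤ) : E.cx.X (n + 1) ⟶ (cone f).cx.X n :=
  (CochainComplex.mappingCone.inl f).v (n + 1) n (by lia)

/-- The inclusion of the target in the cone. -/
def cInr : F.cx ⟶ (cone f).cx := CochainComplex.mappingCone.inr f

@[simp]
lemma cInl_fst (n : ℤ) : cInl f n ≫ cFst f n = 𝟙 _ :=
  CochainComplex.mappingCone.inl_v_fst_v f _ _ _

@[simp]
lemma cInl_fst_assoc (n : ℤ) {T : X.Modules} (z : E.cx.X (n + 1) ⟶ T) :
    cInl f n ≫ cFst f n ≫ z = z := by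
  rw [← Category.assoc, cInl_fst, Category.id_comp]

@[simp]
lemma cInl_snd (n : ℤ) : cInl f n ≫ cSnd f n = 0 :=
  CochainComplex.mappingCone.inl_v_snd_v f _ _ _

@[simp]
lemma cInl_snd_assoc (n : ℤ) {T : X.Modules} (z : F.cx.X n ⟶ T) :
    cInl f n ≫ cSnd f n ≫ z = 0 := by
  rw [← Category.assoc, cInl_snd, zero_comp]

@[simp]
lemma cInr_fst (n : ℤ) : (cInr f).f n ≫ cFst f n = 0 :=
  CochainComplex.mappingCone.inr_f_fst_v f _ _ _

@[simp]
lemma cInr_fst_assoc (n : ℤ) {T : X.Modules} (z : E.cx.X (n + 1) ⟶ T) :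
    (cInr f).f n ≫ cFst f n ≫ z = 0 := by
  rw [← Category.assoc, cInr_fst, zero_comp]

@[simp]
lemma cInr_snd (n : ℤ) : (cInr f).f n ≫ cSnd f n = 𝟙 _ :=
  CochainComplex.mappingCone.inr_f_snd_v f _

@[simp]
lemma cInr_snd_assoc (n : ℤ) {T : X.Modules} (z : F.cx.X n ⟶ T) :
    (cInr f).f n ≫ cSnd f n ≫ z = z := by
  rw [← Category.assoc, cInr_snd, Category.id_comp]

lemma d_cFst (n : ℤ) : (cone f).cx.d n (n + 1) ≫ cFst f (n + 1) =
    - cFst f n ≫ E.cx.d (n + 1) (n + 1 + 1) :=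
  CochainComplex.mappingCone.d_fst_v f _ _ _ _ _

lemma d_cFst_assoc (n : ℤ) {T : X.Modules} (z : E.cx.X (n + 1 + 1) ⟶ T) :
    (cone f).cx.d n (n + 1) ≫ cFst f (n + 1) ≫ z =
      - cFst f n ≫ E.cx.d (n + 1) (n + 1 + 1) ≫ z := by
  rw [← Category.assoc, d_cFst, Preadditive.neg_comp, Category.assoc]

lemma d_cSnd (n : ℤ) : (cone f).cx.d n (n + 1) ≫ cSnd f (n + 1) =
    cFst f n ≫ f.f (n + 1) + cSnd f n ≫ F.cx.d n (n + 1) :=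
  CochainComplex.mappingCone.d_snd_v f _ _ _

lemma d_cSnd_assoc (n : ℤ) {T : X.Modules} (z : F.cx.X (n + 1) ⟶ T) :
    (cone f).cx.d n (n + 1) ≫ cSnd f (n + 1) ≫ z =
      cFst f n ≫ f.f (n + 1) ≫ z + cSnd f n ≫ F.cx.d n (n + 1) ≫ z := by
  rw [← Category.assoc, d_cSnd, Preadditive.add_comp, Category.assoc, Category.assoc]

lemma cone_total (n : ℤ) : cFst f n ≫ cInl f n + cSnd f n ≫ (cInr f).f n = 𝟙 _ :=
  CochainComplex.mappingCone.id_X f _ _ _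

lemma cone_ext_to {n : ℤ} {T : X.Modules} {u v : T ⟶ (cone f).cx.X n}
    (h1 : u ≫ cFst f n = v ≫ cFst f n) (h2 : u ≫ cSnd f n = v ≫ cSnd f n) : u = v := by
  rw [← Category.comp_id u, ← Category.comp_id v, ← cone_total, Preadditive.comp_add,
    Preadditive.comp_add, reassoc_of% h1, reassoc_of% h2]

lemma pull_cone (n : ℤ) {T : X.Modules} (u : T ⟶ (cone f).cx.X n) :
    ((cone f).metric n).pull u =
      (E.metric (n + 1)).pull (u ≫ cFst f n) + (F.metric n).pull (u ≫ cSnd f n) :=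
  HermMetric.pull_orthogonalSum _ _ _ _ (isIso_cone f n) _

/-- The morphism of cones induced by a commutative square. -/
def cMap (a : E.cx ⟶ E'.cx) (b : F.cx ⟶ F'.cx) (w : f ≫ b = a ≫ f') :
    (cone f).cx ⟶ (cone f').cx := CochainComplex.mappingCone.map f f' a b w

variable (a : E.cx ⟶ E'.cx) (b : F.cx ⟶ F'.cx) (w : f ≫ b = a ≫ f')

@[simp]
lemma cMap_fst (n : ℤ) : (cMap f f' a b w).f n ≫ cFst f' n = cFst f n ≫ a.f (n + 1) := by
  change (CochainComplex.mappingCone.map f f' a b w).f n ≫ coneFst f' n =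
    coneFst f n ≫ a.f (n + 1)
  simp [CochainComplex.mappingCone.ext_from_iff _ _ _ rfl, CochainComplex.mappingCone.map]

@[simp]
lemma cMap_fst_assoc (n : ℤ) {T : X.Modules} (z : E'.cx.X (n + 1) ⟶ T) :
    (cMap f f' a b w).f n ≫ cFst f' n ≫ z = cFst f n ≫ a.f (n + 1) ≫ z := by
  rw [← Category.assoc, cMap_fst, Category.assoc]

@[simp]
lemma cMap_snd (n : ℤ) : (cMap f f' a b w).f n ≫ cSnd f' n = cSnd f n ≫ b.f n := by
  change (CochainComplex.mappingCone.map f f' a b w).f n ≫ coneSnd f' n =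
    coneSnd f n ≫ b.f n
  simp [CochainComplex.mappingCone.ext_from_iff _ _ _ rfl, CochainComplex.mappingCone.map]

@[simp]
lemma cMap_snd_assoc (n : ℤ) {T : X.Modules} (z : F'.cx.X n ⟶ T) :
    (cMap f f' a b w).f n ≫ cSnd f' n ≫ z = cSnd f n ≫ b.f n ≫ z := by
  rw [← Category.assoc, cMap_snd, Category.assoc]

end cone

section coneMap

variable {E' F' E F : HermComplex s} {f' : E'.cx ⟶ F'.cx} {f : E.cx ⟶ F.cx}
    {g' : E'.cx ⟶ E.cx} {g : F'.cx ⟶ F.cx} (h : Homotopy (f' ≫ g) (g' ≫ f))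

@[simp]
lemma coneMap_fst (n : ℤ) : (coneMap h).f n ≫ cFst f n = cFst f' n ≫ g'.f (n + 1) := by
  change (CochainComplex.mappingCone.mapOfHomotopy h).f n ≫ coneFst f n =
    coneFst f' n ≫ g'.f (n + 1)
  simp [CochainComplex.mappingCone.ext_from_iff _ _ _ rfl,
    CochainComplex.mappingCone.mapOfHomotopy]

@[simp]
lemma coneMap_fst_assoc (n : ℤ) {T : X.Modules} (z : E.cx.X (n + 1) ⟶ T) :
    (coneMap h).f n ≫ cFst f n ≫ z = cFst f' n ≫ g'.f (n + 1) ≫ z := by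
  rw [← Category.assoc, coneMap_fst, Category.assoc]

@[simp]
lemma coneMap_snd (n : ℤ) : (coneMap h).f n ≫ cSnd f n =
    cFst f' n ≫ h.hom (n + 1) n + cSnd f' n ≫ g.f n := by
  change (CochainComplex.mappingCone.mapOfHomotopy h).f n ≫ coneSnd f n =
    coneFst f' n ≫ h.hom (n + 1) n + coneSnd f' n ≫ g.f n
  simp [CochainComplex.mappingCone.ext_from_iff _ _ _ rfl,
    CochainComplex.mappingCone.mapOfHomotopy]
  rfl

@[simp]
lemma coneMap_snd_assoc (n : ℤ) {T : X.Modules} (z : F.cx.X n ⟶ T) :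
    (coneMap h).f n ≫ cSnd f n ≫ z =
      cFst f' n ≫ h.hom (n + 1) n ≫ z + cSnd f' n ≫ g.f n ≫ z := by
  rw [← Category.assoc, coneMap_snd, Preadditive.add_comp, Category.assoc, Category.assoc]

end coneMap

section dsum

variable (E F : HermComplex s)

/-- The first projection of an orthogonal sum. -/
def dFst : (E.dsum F).cx ⟶ E.cx := (biprod.fst : E.cx ⊞ F.cx ⟶ E.cx)

/-- The second projection of an orthogonal sum. -/
def dSnd : (E.dsum F).cx ⟶ F.cx := (biprod.snd : E.cx ⊞ F.cx ⟶ F.cx)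

/-- The first inclusion in an orthogonal sum. -/
def dInl : E.cx ⟶ (E.dsum F).cx := (biprod.inl : E.cx ⟶ E.cx ⊞ F.cx)

/-- The second inclusion in an orthogonal sum. -/
def dInr : F.cx ⟶ (E.dsum F).cx := (biprod.inr : F.cx ⟶ E.cx ⊞ F.cx)

@[simp]
lemma dInl_fst : dInl E F ≫ dFst E F = 𝟙 _ := biprod.inl_fst

@[simp]
lemma dInl_fst_assoc {K : CochainComplex X.Modules ℤ} (z : E.cx ⟶ K) :
    dInl E F ≫ dFst E F ≫ z = z := by
  rw [← Category.assoc, dInl_fst, Category.id_comp]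

@[simp]
lemma dInl_snd : dInl E F ≫ dSnd E F = 0 := biprod.inl_snd

@[simp]
lemma dInl_snd_assoc {K : CochainComplex X.Modules ℤ} (z : F.cx ⟶ K) :
    dInl E F ≫ dSnd E F ≫ z = 0 := by
  rw [← Category.assoc, dInl_snd, zero_comp]

@[simp]
lemma dInr_fst : dInr E F ≫ dFst E F = 0 := biprod.inr_fst

@[simp]
lemma dInr_fst_assoc {K : CochainComplex X.Modules ℤ} (z : E.cx ⟶ K) :
    dInr E F ≫ dFst E F ≫ z = 0 := by
  rw [← Category.assoc, dInr_fst, zero_comp]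

@[simp]
lemma dInr_snd : dInr E F ≫ dSnd E F = 𝟙 _ := biprod.inr_snd

@[simp]
lemma dInr_snd_assoc {K : CochainComplex X.Modules ℤ} (z : F.cx ⟶ K) :
    dInr E F ≫ dSnd E F ≫ z = z := by
  rw [← Category.assoc, dInr_snd, Category.id_comp]

lemma dsum_total : dFst E F ≫ dInl E F + dSnd E F ≫ dInr E F = 𝟙 _ := biprod.total

lemma pull_dsum (n : ℤ) {T : X.Modules} (u : T ⟶ (E.dsum F).cx.X n) :
    ((E.dsum F).metric n).pull u =
      (E.metric n).pull (u ≫ (dFst E F).f n) + (F.metric n).pull (u ≫ (dSnd E F).f n) :=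
  HermMetric.pull_orthogonalSum _ _ _ _ (isIso_dsum E.cx F.cx n) _

end dsum

section shift

variable (E : HermComplex s)

/-- The identification of a term of `E` with a term of `E[1]`. -/
def toShift (n : ℤ) : E.cx.X (n + 1) ⟶ E.shift.cx.X n := 𝟙 (E.cx.X (n + 1))

/-- The identification of a term of `E[1]` with a term of `E`. -/
def ofShift (n : ℤ) : E.shift.cx.X n ⟶ E.cx.X (n + 1) := 𝟙 (E.cx.X (n + 1))

@[simp]
lemma toShift_ofShift (n : ℤ) : E.toShift n ≫ E.ofShift n = 𝟙 _ :=
  Category.id_comp (𝟙 (E.cx.X (n + 1)))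

@[simp]
lemma toShift_ofShift_assoc (n : ℤ) {T : X.Modules} (z : E.cx.X (n + 1) ⟶ T) :
    E.toShift n ≫ E.ofShift n ≫ z = z := by
  rw [← Category.assoc, toShift_ofShift, Category.id_comp]

@[simp]
lemma ofShift_toShift (n : ℤ) : E.ofShift n ≫ E.toShift n = 𝟙 _ :=
  Category.id_comp (𝟙 (E.cx.X (n + 1)))

@[simp]
lemma ofShift_toShift_assoc (n : ℤ) {T : X.Modules} (z : E.shift.cx.X n ⟶ T) :
    E.ofShift n ≫ E.toShift n ≫ z = z := by
  rw [← Category.assoc, ofShift_toShift, Category.id_comp]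

lemma pull_shift (n : ℤ) {T : X.Modules} (u : T ⟶ E.shift.cx.X n) :
    (E.shift.metric n).pull u = (E.metric (n + 1)).pull (u ≫ E.ofShift n) :=
  congrArg (E.metric (n + 1)).pull (Category.comp_id (X := T) (Y := E.cx.X (n + 1)) u).symm

lemma d_ofShift (n : ℤ) : E.shift.cx.d n (n + 1) ≫ E.ofShift (n + 1) =
    - E.ofShift n ≫ E.cx.d (n + 1) (n + 1 + 1) := by
  have h : (E.cx⟦(1 : ℤ)⟧).d n (n + 1) = - E.cx.d (n + 1) (n + 1 + 1) := by simp
  refine (Category.comp_id (X := E.cx.X (n + 1)) (Y := E.cx.X (n + 1 + 1)) _).trans (h.trans ?_)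
  exact congrArg (- ·) (Category.id_comp (E.cx.d (n + 1) (n + 1 + 1))).symm

lemma d_ofShift_assoc (n : ℤ) {T : X.Modules} (z : E.cx.X (n + 1 + 1) ⟶ T) :
    E.shift.cx.d n (n + 1) ≫ E.ofShift (n + 1) ≫ z =
      - E.ofShift n ≫ E.cx.d (n + 1) (n + 1 + 1) ≫ z := by
  rw [← Category.assoc, d_ofShift, Preadditive.neg_comp, Category.assoc]

/-- The shift of a morphism. -/
def shiftMap {E F : HermComplex s} (f : E.cx ⟶ F.cx) : E.shift.cx ⟶ F.shift.cx := f⟦(1 : ℤ)⟧'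

@[simp]
lemma shiftMap_ofShift {E F : HermComplex s} (f : E.cx ⟶ F.cx) (n : ℤ) :
    (shiftMap f).f n ≫ F.ofShift n = E.ofShift n ≫ f.f (n + 1) :=
  (Category.comp_id (f.f (n + 1))).trans (Category.id_comp (f.f (n + 1))).symm

@[simp]
lemma shiftMap_ofShift_assoc {E F : HermComplex s} (f : E.cx ⟶ F.cx) (n : ℤ) {T : X.Modules} 
    (z : F.cx.X (n + 1) ⟶ T) :
    (shiftMap f).f n ≫ F.ofShift n ≫ z = E.ofShift n ≫ f.f (n + 1) ≫ z := by
  rw [← Category.assoc, shiftMap_ofShift, Category.assoc]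

end shift

/-! ### Degreewise orthogonal extensions and their connecting morphisms. -/

/-- An extension of `C` by `A` which is in each degree an orthogonal direct sum. -/
structure OrthExt (A B C : HermComplex s) where
  i : A.cx ⟶ B.cx
  p : B.cx ⟶ C.cx
  r : ∀ n, B.cx.X n ⟶ A.cx.X n
  j : ∀ n, C.cx.X n ⟶ B.cx.X n
  i_p : i ≫ p = 0
  i_r : ∀ n, i.f n ≫ r n = 𝟙 _
  j_p : ∀ n, j n ≫ p.f n = 𝟙 _
  total : ∀ n, r n ≫ i.f n + p.f n ≫ j n = 𝟙 _
  pull_id : ∀ n, (B.metric n).pull (𝟙 _) = (A.metric n).pull (r n) + (C.metric n).pull (p.f n)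

namespace OrthExt

variable {A B C : HermComplex s} (S : OrthExt A B C)

/-- The underlying short complex. -/
abbrev shortComplex : ShortComplex (CochainComplex X.Modules ℤ) := ShortComplex.mk S.i S.p S.i_p

/-- The degreewise splitting of the underlying short complex. -/
def splitting (n : ℤ) :
    (S.shortComplex.map (HomologicalComplex.eval X.Modules (ComplexShape.up ℤ) n)).Splitting where
  r := S.r n
  s := S.j n
  f_r := S.i_r n
  s_g := S.j_p n
  id := S.total n

/-- The connecting morphism. -/
def connecting : C.cx ⟶ A.shift.cx :=
  CochainComplex.homOfDegreewiseSplit S.shortComplex S.splitting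

/-- In components the comparison isomorphism is `p` into the source summand and minus `r` into the
target summand. The sign is invisible to the metric, so the claim becomes the orthogonality
`S.pull_id`. -/
lemma isometric_cone_connecting : Isometric B.shift (cone (F := A.shift) S.connecting) := by
  let e : B.shift.cx ≅ (cone (F := A.shift) S.connecting).cx :=
    (CochainComplex.mappingConeHomOfDegreewiseSplitIso S.shortComplex S.splitting).symm
  refine isometric_iff.2 ⟨e, fun n => ?_⟩
  have h : e.hom.f n = B.ofShift n ≫ (S.p.f (n + 1) ≫ cInl (F := A.shift) S.connecting n -
      S.r (n + 1) ≫ A.toShift n ≫ (cInr (F := A.shift) S.connecting).f n) := by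
    exact (Category.id_comp (X := B.cx.X (n + 1)) _).symm
  rw [h, pull_shift, Category.id_comp]
  rw [← Category.comp_id (B.ofShift n)]
  simp only [Category.assoc]
  refine (HermMetric.pull_comp_congr (h' := B.metric (n + 1)) (p' := 𝟙 _) ?_ _)
  rw [Category.id_comp, pull_cone, pull_shift, S.pull_id]
  simp [Preadditive.sub_comp, add_comm]

end OrthExt

/-! ### Acyclicity -/

section acyclic

open Pretriangulated

/-- Acyclic complexes form a triangulated subcategory of the homotopy category, and the cone
triangle is distinguished. This and the next two lemmas are its two-out-of-three property. -/
lemma acyclic_cone {E F : HermComplex s} (f : E.cx ⟶ F.cx) (hE : E.cx.Acyclic)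
    (hF : F.cx.Acyclic) : (cone f).cx.Acyclic := by
  rw [← HomotopyCategory.quotient_obj_mem_subcategoryAcyclic_iff_acyclic] at *
  exact ObjectProperty.ext_of_isTriangulatedClosed₃ _ _
    (HomotopyCategory.mappingCone_triangleh_distinguished f) hE hF

lemma acyclic_target {E F : HermComplex s} (f : E.cx ⟶ F.cx) (hE : E.cx.Acyclic)
    (hf : (cone f).cx.Acyclic) : F.cx.Acyclic := by
  rw [← HomotopyCategory.quotient_obj_mem_subcategoryAcyclic_iff_acyclic] at *
  exact ObjectProperty.ext_of_isTriangulatedClosed₂ _ _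
    (HomotopyCategory.mappingCone_triangleh_distinguished f) hE hf

lemma acyclic_source {E F : HermComplex s} (f : E.cx ⟶ F.cx) (hF : F.cx.Acyclic)
    (hf : (cone f).cx.Acyclic) : E.cx.Acyclic := by
  rw [← HomotopyCategory.quotient_obj_mem_subcategoryAcyclic_iff_acyclic] at *
  exact ObjectProperty.ext_of_isTriangulatedClosed₁ _ _
    (HomotopyCategory.mappingCone_triangleh_distinguished f) hF hf

lemma acyclic_cone_iff {E F : HermComplex s} (f : E.cx ⟶ F.cx) :
    (cone f).cx.Acyclic ↔ QuasiIso f := by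
  rw [← HomologicalComplex.mem_quasiIso_iff, ← HomotopyCategory.quotient_map_mem_quasiIso_iff,
    HomotopyCategory.quasiIso_eq_trW_subcategoryAcyclic,
    ← HomotopyCategory.quotient_obj_mem_subcategoryAcyclic_iff_acyclic]
  exact (ObjectProperty.trW_iff_of_distinguished _ _
    (HomotopyCategory.mappingCone_triangleh_distinguished f)).symm

/-- In this form acyclicity passes to retracts and direct sums: it suffices to write the identity as
a sum of maps that factor through acyclic complexes. -/
lemma acyclic_iff_homologyMap_id (K : CochainComplex X.Modules ℤ) :
    K.Acyclic ↔ ∀ n, HomologicalComplex.homologyMap (𝟙 K) n = 0 := by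
  refine forall_congr' fun n => ?_
  rw [HomologicalComplex.exactAt_iff_isZero_homology, IsZero.iff_id_eq_zero,
    HomologicalComplex.homologyMap_id]

lemma homologyMap_comp_eq_zero {K L M : CochainComplex X.Modules ℤ} (hL : L.Acyclic)
    (f : K ⟶ L) (g : L ⟶ M) (n : ℤ) : HomologicalComplex.homologyMap (f ≫ g) n = 0 := by
  have h := (acyclic_iff_homologyMap_id L).1 hL n
  rw [← Category.id_comp g, HomologicalComplex.homologyMap_comp,
    HomologicalComplex.homologyMap_comp, h, zero_comp, comp_zero]

lemma acyclic_of_retract {K L : CochainComplex X.Modules ℤ} (i : K ⟶ L) (r : L ⟶ K)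
    (h : i ≫ r = 𝟙 K) (hL : L.Acyclic) : K.Acyclic :=
  (acyclic_iff_homologyMap_id K).2 fun n => by rw [← h, homologyMap_comp_eq_zero hL]

lemma acyclic_dsum {E F : HermComplex s} (hE : E.cx.Acyclic) (hF : F.cx.Acyclic) :
    (E.dsum F).cx.Acyclic :=
  (acyclic_iff_homologyMap_id _).2 fun n => by
    rw [← dsum_total, HomologicalComplex.homologyMap_add, homologyMap_comp_eq_zero hE,
      homologyMap_comp_eq_zero hF, add_zero]

lemma acyclic_shift {E : HermComplex s} (hE : E.cx.Acyclic) : E.shift.cx.Acyclic := fun n => by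
  have h := hE (n + 1)
  rw [HomologicalComplex.exactAt_iff_isZero_homology] at h ⊢
  exact h.of_iso ((CochainComplex.ShiftSequence.shiftIso X.Modules 1 n (n + 1) (by lia)).app E.cx)

/-- A cocycle in degree n + 1 has no component in A^{n+2}, hence lies in A^{n+1}, which is also a
summand of E^n and is mapped identically by the differential. -/
lemma OrthogonallySplit.acyclic {E : HermComplex s} (h : OrthogonallySplit E) :
    E.cx.Acyclic := by
  obtain ⟨A, p, q, h⟩ := h
  have key : ∀ n, E.cx.ExactAt (n + 1) := fun n => by
    rw [E.cx.exactAt_iff' n (n + 1) (n + 1 + 1) (by simp) (by simp),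
      ShortComplex.exact_iff_exact_up_to_refinements]
    intro T u hu
    change T ⟶ E.cx.X (n + 1) at u
    change u ≫ E.cx.d (n + 1) (n + 1 + 1) = 0 at hu
    obtain ⟨⟨hi, -⟩, hp, hq⟩ := h n
    obtain ⟨⟨hi', -⟩, hp', -⟩ := h (n + 1)
    let j : (A (n + 1)).obj ⟶ E.cx.X n := biprod.inr ≫ inv (biprod.lift (p n) (q n))
    have hj : j ≫ q n = 𝟙 _ := by
      calc j ≫ q n = j ≫ biprod.lift (p n) (q n) ≫ biprod.snd := by rw [biprod.lift_snd]
        _ = 𝟙 _ := by simp only [j, Category.assoc, IsIso.inv_hom_id_assoc, biprod.inr_snd]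
    have huq : u ≫ q (n + 1) = 0 := by rw [← hp', reassoc_of% hu, zero_comp]
    refine ⟨T, 𝟙 T, inferInstance, u ≫ p (n + 1) ≫ j, ?_⟩
    change 𝟙 T ≫ u = (u ≫ p (n + 1) ≫ j) ≫ E.cx.d n (n + 1)
    rw [← cancel_mono (biprod.lift (p (n + 1)) (q (n + 1)))]
    apply biprod.hom_ext
    · simp [hp, hj]
    · simp [hq, huq]
  intro n
  simpa using key (n - 1)

lemma acyclic_of_isometric {E F : HermComplex s} (h : Isometric E F) (hF : F.cx.Acyclic) :
    E.cx.Acyclic :=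
  let ⟨φ, _⟩ := h
  acyclic_of_retract φ.hom φ.inv φ.hom_inv_id hF

lemma Meager.acyclic {E : HermComplex s} (h : Meager E) : E.cx.Acyclic := by
  induction h with
  | orthogonallySplit E h => exact h.acyclic
  | dsumShift E F hF h => exact acyclic_of_isometric h (acyclic_dsum hF (acyclic_shift hF))
  | cone f _ _ hE hF => exact acyclic_cone f hE hF
  | target f _ _ hE hf => exact acyclic_target f hE hf
  | source f _ _ hF hf => exact acyclic_source f hF hf

end acyclic

/-! ### Construction of isometries -/

/-- A morphism of complexes indexed by `ℤ` from its components. -/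
def homMk {K L : CochainComplex X.Modules ℤ} (u : ∀ n, K.X n ⟶ L.X n)
    (h : ∀ n, u n ≫ L.d n (n + 1) = K.d n (n + 1) ≫ u (n + 1)) : K ⟶ L where
  f := u
  comm' := by
    rintro n _ rfl
    exact h n

@[simp]
lemma homMk_f {K L : CochainComplex X.Modules ℤ} (u : ∀ n, K.X n ⟶ L.X n)
    (h : ∀ n, u n ≫ L.d n (n + 1) = K.d n (n + 1) ≫ u (n + 1)) (n : ℤ) :
    (homMk u h).f n = u n := rfl

lemma exists_isIsometry_of_hom {E F : HermComplex s} (u : E.cx ⟶ F.cx)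
    (v : ∀ n, F.cx.X n ⟶ E.cx.X n) (h1 : ∀ n, u.f n ≫ v n = 𝟙 _) (h2 : ∀ n, v n ≫ u.f n = 𝟙 _)
    (hp : ∀ n, (F.metric n).pull (u.f n) = (E.metric n).pull (𝟙 _)) :
    ∃ φ : E.cx ≅ F.cx, φ.hom = u ∧ IsIsometry E F φ := by
  let e : E.cx ≅ F.cx := HomologicalComplex.Hom.isoOfComponents
    (fun n => ⟨u.f n, v n, h1 n, h2 n⟩) (fun i j _ => u.comm i j)
  have he : e.hom = u := by ext n; rfl
  exact ⟨e, he, fun n => by rw [he, hp]⟩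

/-- The inverse is required only degree by degree; its compatibility with differentials is
automatic. -/
lemma isometric_of_hom {E F : HermComplex s} (u : E.cx ⟶ F.cx) (v : ∀ n, F.cx.X n ⟶ E.cx.X n)
    (h1 : ∀ n, u.f n ≫ v n = 𝟙 _) (h2 : ∀ n, v n ≫ u.f n = 𝟙 _)
    (hp : ∀ n, (F.metric n).pull (u.f n) = (E.metric n).pull (𝟙 _)) : Isometric E F :=
  let ⟨φ, _, h⟩ := exists_isIsometry_of_hom u v h1 h2 hp
  isometric_iff.2 ⟨φ, h⟩

lemma shift_ext_to {E : HermComplex s} {n : ℤ} {T : X.Modules} {u v : T ⟶ E.shift.cx.X n}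
    (h : u ≫ E.ofShift n = v ≫ E.ofShift n) : u = v := by
  rw [← Category.comp_id u, ← Category.comp_id v, ← ofShift_toShift, reassoc_of% h]

/-- The morphism `cone(f) ⟶ E[1]`. -/
def cToShift {E F : HermComplex s} (f : E.cx ⟶ F.cx) : (cone f).cx ⟶ E.shift.cx :=
  homMk (fun n => cFst f n ≫ E.toShift n) fun n => by
    apply shift_ext_to
    simp [d_ofShift, d_cFst]

@[simp]
lemma cToShift_ofShift {E F : HermComplex s} (f : E.cx ⟶ F.cx) (n : ℤ) :
    (cToShift f).f n ≫ E.ofShift n = cFst f n := by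
  simp [cToShift]

@[simp]
lemma cToShift_ofShift_assoc {E F : HermComplex s} (f : E.cx ⟶ F.cx) (n : ℤ) {T : X.Modules} 
    (z : E.cx.X (n + 1) ⟶ T) :
    (cToShift f).f n ≫ E.ofShift n ≫ z = cFst f n ≫ z := by
  rw [← Category.assoc, cToShift_ofShift]

lemma dsum_ext_to {E F : HermComplex s} {n : ℤ} {T : X.Modules} {u v : T ⟶ (E.dsum F).cx.X n}
    (h1 : u ≫ (dFst E F).f n = v ≫ (dFst E F).f n)
    (h2 : u ≫ (dSnd E F).f n = v ≫ (dSnd E F).f n) : u = v := by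
  have h : (dFst E F).f n ≫ (dInl E F).f n + (dSnd E F).f n ≫ (dInr E F).f n = 𝟙 _ := by
    rw [← HomologicalComplex.comp_f, ← HomologicalComplex.comp_f,
      ← HomologicalComplex.add_f_apply, dsum_total, HomologicalComplex.id_f]
  rw [← Category.comp_id u, ← Category.comp_id v, ← h, Preadditive.comp_add,
    Preadditive.comp_add, reassoc_of% h1, reassoc_of% h2]

section components

variable (E F : HermComplex s) (n : ℤ)

@[simp]
lemma dInl_fst_f : (dInl E F).f n ≫ (dFst E F).f n = 𝟙 _ := by
  rw [← HomologicalComplex.comp_f, dInl_fst, HomologicalComplex.id_f]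

@[simp]
lemma dInl_fst_f_assoc {T : X.Modules} (z : E.cx.X n ⟶ T) :
    (dInl E F).f n ≫ (dFst E F).f n ≫ z = z := by
  rw [← Category.assoc, dInl_fst_f, Category.id_comp]

@[simp]
lemma dInl_snd_f : (dInl E F).f n ≫ (dSnd E F).f n = 0 := by
  rw [← HomologicalComplex.comp_f, dInl_snd, HomologicalComplex.zero_f]

@[simp]
lemma dInl_snd_f_assoc {T : X.Modules} (z : F.cx.X n ⟶ T) :
    (dInl E F).f n ≫ (dSnd E F).f n ≫ z = 0 := by
  rw [← Category.assoc, dInl_snd_f, zero_comp]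

@[simp]
lemma dInr_fst_f : (dInr E F).f n ≫ (dFst E F).f n = 0 := by
  rw [← HomologicalComplex.comp_f, dInr_fst, HomologicalComplex.zero_f]

@[simp]
lemma dInr_fst_f_assoc {T : X.Modules} (z : E.cx.X n ⟶ T) :
    (dInr E F).f n ≫ (dFst E F).f n ≫ z = 0 := by
  rw [← Category.assoc, dInr_fst_f, zero_comp]

@[simp]
lemma dInr_snd_f : (dInr E F).f n ≫ (dSnd E F).f n = 𝟙 _ := by
  rw [← HomologicalComplex.comp_f, dInr_snd, HomologicalComplex.id_f]

@[simp]
lemma dInr_snd_f_assoc {T : X.Modules} (z : F.cx.X n ⟶ T) :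
    (dInr E F).f n ≫ (dSnd E F).f n ≫ z = z := by
  rw [← Category.assoc, dInr_snd_f, Category.id_comp]

end components

lemma Isometric.dsum {E E' F F' : HermComplex s} (h : Isometric E E') (h' : Isometric F F') :
    Isometric (E.dsum F) (E'.dsum F') := by
  obtain ⟨φ, h⟩ := isometric_iff.1 h
  obtain ⟨ψ, h'⟩ := isometric_iff.1 h'
  refine isometric_of_hom (dFst E F ≫ φ.hom ≫ dInl E' F' + dSnd E F ≫ ψ.hom ≫ dInr E' F')
    (fun n => (dFst E' F' ≫ φ.inv ≫ dInl E F + dSnd E' F' ≫ ψ.inv ≫ dInr E F).f n)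
    (fun n => ?_) (fun n => ?_) (fun n => ?_)
  · apply dsum_ext_to <;> simp [← HomologicalComplex.comp_f]
  · apply dsum_ext_to <;> simp [← HomologicalComplex.comp_f]
  · rw [pull_dsum, pull_dsum]
    have h1 := HermMetric.pull_comp_congr (h n) ((dFst E F).f n)
    have h2 := HermMetric.pull_comp_congr (h' n) ((dSnd E F).f n)
    simp only [Category.comp_id] at h1 h2
    simp [h1, h2]

lemma Isometric.shift {E F : HermComplex s} (h : Isometric E F) :
    Isometric E.shift F.shift := by
  obtain ⟨φ, h⟩ := isometric_iff.1 h
  refine isometric_of_hom (shiftMap φ.hom) (fun n => (shiftMap φ.inv).f n)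
    (fun n => ?_) (fun n => ?_) (fun n => ?_)
  · apply shift_ext_to
    simp only [Category.assoc, shiftMap_ofShift, shiftMap_ofShift_assoc, Category.id_comp]
    rw [← HomologicalComplex.comp_f, φ.hom_inv_id, HomologicalComplex.id_f, Category.comp_id]
  · apply shift_ext_to
    simp only [Category.assoc, shiftMap_ofShift, shiftMap_ofShift_assoc, Category.id_comp]
    rw [← HomologicalComplex.comp_f, φ.inv_hom_id, HomologicalComplex.id_f, Category.comp_id]
  · rw [pull_shift, pull_shift, shiftMap_ofShift, Category.id_comp]
    simpa using HermMetric.pull_comp_congr (h (n + 1)) (E.ofShift n)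

lemma isometric_dsum_comm (E F : HermComplex s) : Isometric (E.dsum F) (F.dsum E) := by
  refine isometric_of_hom (dFst E F ≫ dInr F E + dSnd E F ≫ dInl F E)
    (fun n => (dFst F E ≫ dInr E F + dSnd F E ≫ dInl E F).f n)
    (fun n => ?_) (fun n => ?_) (fun n => ?_)
  · apply dsum_ext_to <;> simp
  · apply dsum_ext_to <;> simp
  · rw [pull_dsum, pull_dsum, add_comm]
    simp

lemma isometric_dsum_assoc (E F G : HermComplex s) :
    Isometric ((E.dsum F).dsum G) (E.dsum (F.dsum G)) := by
  refine isometric_of_hom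
    (dFst _ _ ≫ dFst _ _ ≫ dInl _ _ + (dFst _ _ ≫ dSnd _ _ ≫ dInl _ _ +
      dSnd _ _ ≫ dInr _ _) ≫ dInr _ _)
    (fun n => ((dFst _ _ ≫ dInl _ _ + dSnd _ _ ≫ dFst _ _ ≫ dInr _ _) ≫ dInl _ _ +
      dSnd _ _ ≫ dSnd _ _ ≫ dInr _ _).f n)
    (fun n => ?_) (fun n => ?_) (fun n => ?_)
  · apply dsum_ext_to
    · apply dsum_ext_to <;> simp
    · simp
  · apply dsum_ext_to
    · simp
    · apply dsum_ext_to <;> simp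
  · simp [pull_dsum, add_assoc]

lemma isometric_cone_zero (E F : HermComplex s) :
    Isometric (cone (0 : E.cx ⟶ F.cx)) (E.shift.dsum F) := by
  refine isometric_of_hom (cToShift (0 : E.cx ⟶ F.cx) ≫ dInl _ _ +
      homMk (fun n => cSnd (0 : E.cx ⟶ F.cx) n) (fun n => by rw [d_cSnd]; simp) ≫ dInr _ _)
    (fun n => (dFst E.shift F).f n ≫ E.ofShift n ≫ cInl _ n + (dSnd E.shift F).f n ≫
      (cInr (0 : E.cx ⟶ F.cx)).f n)
    (fun n => ?_) (fun n => ?_) (fun n => ?_)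
  · apply cone_ext_to <;> simp
  · apply dsum_ext_to
    · apply shift_ext_to; simp
    · simp
  · rw [pull_dsum, pull_cone, pull_shift]
    simp

/-! ### First properties of meager complexes -/

/-- The cone of the zero morphism F ⟶ E is F[1] ⊕ E, isometric to E ⊕ E[1]. Since E is acyclic, this
is meager by `Meager.dsumShift`, and two-out-of-three applies. -/
lemma Meager.of_isometric {E F : HermComplex s} (hF : Meager F) (h : Isometric E F) :
    Meager E :=
  Meager.target (0 : F.cx ⟶ E.cx) hF (Meager.dsumShift _ E (acyclic_of_isometric h hF.acyclic)
    ((isometric_cone_zero F E).trans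
      ((h.symm.shift.dsum (.refl E)).trans (isometric_dsum_comm _ _))))

lemma meager_iff_of_isometric {E F : HermComplex s} (h : Isometric E F) : Meager E ↔ Meager F :=
  ⟨fun hE => hE.of_isometric h.symm, fun hF => hF.of_isometric h⟩

/-! ### Zero complexes and shifts -/

lemma isZero_zero_X (n : ℤ) : IsZero ((zero s).cx.X n) :=
  isZero_zero _

lemma meager_zero : Meager (zero s) :=
  .orthogonallySplit _ ⟨fun n => ⟨_, (zero s).isVectorBundle n, (zero s).metric n⟩,
    fun _ => 𝟙 _, fun _ => 0, fun n => by
    refine ⟨⟨⟨biprod.fst, (isZero_zero_X n).eq_of_src _ _, ?_⟩, fun x v w => ?_⟩,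
      (isZero_zero_X n).eq_of_src _ _, (isZero_zero_X n).eq_of_src _ _⟩
    · apply biprod.hom_ext
      · exact (isZero_zero_X (s := s) n).eq_of_tgt _ _
      · exact (isZero_zero_X (s := s) (n + 1)).eq_of_tgt _ _
    · change (0 : ℂ) = 0 + 0
      simp⟩

lemma isometric_cone_to_zero {E : HermComplex s} (f : E.cx ⟶ (zero s).cx) :
    Isometric (cone f) E.shift := by
  refine isometric_of_hom (cToShift f) (fun n => E.ofShift n ≫ cInl f n)
    (fun n => ?_) (fun n => ?_) (fun n => ?_)
  · apply cone_ext_to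
    · simp
    · exact (isZero_zero_X n).eq_of_tgt _ _
  · apply shift_ext_to; simp
  · rw [pull_cone, pull_shift, (isZero_zero_X n).eq_of_tgt (𝟙 _ ≫ cSnd f n) 0]
    simp

/-- E[1] is the cone of E ⟶ 0, and 0 is meager. -/
lemma meager_shift_iff (E : HermComplex s) : Meager E.shift ↔ Meager E := by
  have h : Meager E.shift ↔ Meager (cone (0 : E.cx ⟶ (zero s).cx)) :=
    (meager_iff_of_isometric (isometric_cone_to_zero _)).symm
  rw [h]
  exact ⟨fun h => .source _ meager_zero h, fun h => .cone _ h meager_zero⟩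

/-! ### Orthogonal extensions -/

namespace OrthExt

lemma i_p_f {A B C : HermComplex s} (S : OrthExt A B C) (n : ℤ) : S.i.f n ≫ S.p.f n = 0 := by
  rw [← HomologicalComplex.comp_f, S.i_p, HomologicalComplex.zero_f]

attribute [simp] i_p i_r j_p i_p_f

section

variable {A B C : HermComplex s} (S : OrthExt A B C)

@[simp]
lemma i_r_assoc (n : ℤ) {T : X.Modules} (z : A.cx.X n ⟶ T) :
    S.i.f n ≫ S.r n ≫ z = z := by
  rw [← Category.assoc, i_r, Category.id_comp]

include S in
lemma meager_middle (hA : Meager A) (hC : Meager C) : Meager B := by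
  rw [← meager_shift_iff] at hA ⊢
  exact (Meager.cone S.connecting hC hA).of_isometric S.isometric_cone_connecting

end

/-- The target of a morphism is a subobject of the cone, with quotient the shift of the source. -/
def ofCone {E F : HermComplex s} (f : E.cx ⟶ F.cx) : OrthExt F (cone f) E.shift where
  i := cInr f
  p := cToShift f
  r := cSnd f
  j n := E.ofShift n ≫ cInl f n
  i_p := by ext n : 1; apply shift_ext_to; simp
  i_r n := by simp
  j_p n := by apply shift_ext_to; simp
  total n := by apply cone_ext_to <;> simp
  pull_id n := by rw [pull_cone, pull_shift, add_comm]; simp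

/-- A direct sum as an extension of the second summand by the first. -/
def ofDsum (E F : HermComplex s) : OrthExt E (E.dsum F) F where
  i := dInl E F
  p := dSnd E F
  r := (dFst E F).f
  j := (dInr E F).f
  i_p := by simp
  i_r n := by simp
  j_p n := by simp
  total n := by apply dsum_ext_to <;> simp
  pull_id n := by rw [pull_dsum]; simp

/-- The extension of `0` by `A`. -/
def ofIdLeft (A : HermComplex s) : OrthExt A A (zero s) where
  i := 𝟙 _
  p := 0
  r _ := 𝟙 _
  j _ := 0
  i_p := by simp
  i_r n := by simp
  j_p n := (isZero_zero_X n).eq_of_src _ _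
  total n := by simp
  pull_id n := by simp

/-- The extension of `C` by `0`. -/
def ofIdRight (C : HermComplex s) : OrthExt (zero s) C C where
  i := 0
  p := 𝟙 _
  r _ := 0
  j _ := 𝟙 _
  i_p := by simp
  i_r n := (isZero_zero_X n).eq_of_src _ _
  j_p n := by simp
  total n := by simp
  pull_id n := by simp

/-- The cones of the components of a morphism of extensions form an extension. -/
def coneOf {A B C A' B' C' : HermComplex s} (S : OrthExt A B C) (S' : OrthExt A' B' C')
    (α : A.cx ⟶ A'.cx) (β : B.cx ⟶ B'.cx) (γ : C.cx ⟶ C'.cx)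
    (hi : α ≫ S'.i = S.i ≫ β) (hp : β ≫ S'.p = S.p ≫ γ) :
    OrthExt (cone α) (cone β) (cone γ) where
  i := cMap α β S.i S'.i hi
  p := cMap β γ S.p S'.p hp
  r n := cFst β n ≫ S.r (n + 1) ≫ cInl α n + cSnd β n ≫ S'.r n ≫ (cInr α).f n
  j n := cFst γ n ≫ S.j (n + 1) ≫ cInl β n + cSnd γ n ≫ S'.j n ≫ (cInr β).f n
  i_p := by ext n : 1; apply cone_ext_to <;> simp
  i_r n := by apply cone_ext_to <;> simp
  j_p n := by apply cone_ext_to <;> simp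
  total n := by
    apply cone_ext_to
    · simp only [Preadditive.add_comp, Preadditive.comp_add, Category.assoc, cMap_fst,
        cMap_fst_assoc, cMap_snd_assoc, cInl_fst, cInr_fst, cInl_fst_assoc, cInr_fst_assoc,
        comp_zero, add_zero, Category.comp_id, Category.id_comp]
      rw [← Preadditive.comp_add, S.total, Category.comp_id]
    · simp only [Preadditive.add_comp, Preadditive.comp_add, Category.assoc, cMap_snd,
        cMap_fst_assoc, cMap_snd_assoc, cInl_snd, cInr_snd, cInl_snd_assoc, cInr_snd_assoc,
        comp_zero, zero_add, Category.comp_id, Category.id_comp]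
      rw [← Preadditive.comp_add, S'.total, Category.comp_id]
  pull_id n := by
    have h1 := HermMetric.pull_comp_congr₂ (S.pull_id (n + 1)) (cFst β n)
    have h2 := HermMetric.pull_comp_congr₂ (S'.pull_id n) (cSnd β n)
    simp only [Category.comp_id] at h1 h2
    rw [pull_cone, pull_cone, pull_cone]
    simp only [Category.id_comp, h1, h2, cMap_fst, cMap_snd, Preadditive.add_comp, Category.assoc,
      cInl_fst, cInr_fst, cInl_snd, cInr_snd, comp_zero, add_zero, zero_add, Category.comp_id]
    abel

end OrthExt

/-! ### Stupid truncations and cones of identities -/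

lemma isZero_of_retract {A B : X.Modules} (i : A ⟶ B) (r : B ⟶ A) (h : i ≫ r = 𝟙 A)
    (hB : IsZero B) : IsZero A := by
  rw [IsZero.iff_id_eq_zero, ← h, hB.eq_of_tgt i 0, zero_comp]

/-- Stupid truncation: the subcomplex A consists of the terms of degree at least k, the quotient C
of those below k. Only the vanishing of differentials is recorded, since the induction in
`meager_cone_id` counts possibly nonzero differentials. -/
lemma exists_orthExt_truncation (E : HermComplex s) (k : ℤ) :
    ∃ A C : HermComplex s, Nonempty (OrthExt A E C) ∧
      (∀ n, E.cx.d n (n + 1) = 0 → A.cx.d n (n + 1) = 0 ∧ C.cx.d n (n + 1) = 0) ∧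
      (∀ n, n < k → A.cx.d n (n + 1) = 0) ∧ (∀ n, k ≤ n + 1 → C.cx.d n (n + 1) = 0) := by
  have h : ∀ n, ∃ (A C : X.Modules) (_ : IsVectorBundle A) (_ : IsVectorBundle C)
      (mA : HermMetric s A) (mC : HermMetric s C) (i : A ⟶ E.cx.X n) (r : E.cx.X n ⟶ A)
      (j : C ⟶ E.cx.X n) (p : E.cx.X n ⟶ C),
      i ≫ r = 𝟙 A ∧ j ≫ p = 𝟙 C ∧ i ≫ p = 0 ∧ r ≫ i + p ≫ j = 𝟙 _ ∧
      (E.metric n).pull (𝟙 _) = mA.pull r + mC.pull p ∧ (n < k → IsZero A) ∧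
      (k ≤ n → IsZero C) := by
    intro n
    have hz := isZero_zero_X (s := s) n
    by_cases hn : n < k
    · exact ⟨(zero s).cx.X n, E.cx.X n, (zero s).isVectorBundle n, E.isVectorBundle n,
        (zero s).metric n, E.metric n, 0, 0, 𝟙 _, 𝟙 _, hz.eq_of_src _ _, by simp, by simp,
        by simp, by simp, fun _ => hz, fun h => by lia⟩
    · exact ⟨E.cx.X n, (zero s).cx.X n, E.isVectorBundle n, (zero s).isVectorBundle n,
        E.metric n, (zero s).metric n, 𝟙 _, 𝟙 _, 0, 0, by simp, hz.eq_of_src _ _, by simp,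
        by simp, by simp, fun h => by lia, fun _ => hz⟩
  choose A C vA vC mA mC i r j p hir hjp hip ht hpull hA hC using h
  -- The differential raises degrees, so it never leads from degrees at least k to degrees below k;
  -- hence A is a subcomplex.
  have hd : ∀ n m, i n ≫ E.cx.d n m ≫ p m = 0 := by
    intro n m
    by_cases hnm : n + 1 = m
    · by_cases hn : n < k
      · rw [(hA n hn).eq_of_src (i n) 0, zero_comp]
      · rw [(hC m (by lia)).eq_of_tgt (p m) 0, comp_zero, comp_zero]
    · rw [E.cx.shape n m hnm, zero_comp, comp_zero]
  have hri : ∀ n m, i n ≫ E.cx.d n m ≫ r m ≫ i m = i n ≫ E.cx.d n m := by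
    intro n m
    have h1 : r m ≫ i m = 𝟙 _ - p m ≫ j m := eq_sub_of_add_eq (ht m)
    rw [h1, Preadditive.comp_sub, Preadditive.comp_sub, reassoc_of% (hd n m), zero_comp,
      Category.comp_id, sub_zero]
  have hpj : ∀ n m, p n ≫ j n ≫ E.cx.d n m ≫ p m = E.cx.d n m ≫ p m := by
    intro n m
    have h1 : p n ≫ j n = 𝟙 _ - r n ≫ i n := eq_sub_of_add_eq' (ht n)
    rw [reassoc_of% h1, Preadditive.sub_comp, Category.assoc, hd, comp_zero, Category.id_comp,
      sub_zero]
  obtain ⟨N, hN⟩ := E.bounded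
  let A' : HermComplex s :=
    { cx :=
        { X := A
          d := fun n m => i n ≫ E.cx.d n m ≫ r m
          shape := fun n m h => by rw [E.cx.shape n m h, zero_comp, comp_zero]
          d_comp_d' := fun n m l _ _ => by
            rw [Category.assoc, Category.assoc, reassoc_of% (hri n m)]
            simp }
      bounded := ⟨N, fun n hn => isZero_of_retract _ _ (hir n) (hN n hn)⟩
      isVectorBundle := vA
      metric := mA }
  let C' : HermComplex s :=
    { cx :=
        { X := C
          d := fun n m => j n ≫ E.cx.d n m ≫ p m
          shape := fun n m h => by rw [E.cx.shape n m h, zero_comp, comp_zero]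
          d_comp_d' := fun n m l _ _ => by
            rw [Category.assoc, Category.assoc, hpj m l]
            simp }
      bounded := ⟨N, fun n hn => isZero_of_retract _ _ (hjp n) (hN n hn)⟩
      isVectorBundle := vC
      metric := mC }
  let S : OrthExt A' E C' :=
    { i := homMk i fun n => by
        change i n ≫ E.cx.d n (n + 1) = (i n ≫ E.cx.d n (n + 1) ≫ r (n + 1)) ≫ i (n + 1)
        rw [Category.assoc, Category.assoc, hri]
      p := homMk p fun n => hpj n (n + 1)
      r := r
      j := j
      i_p := by ext n : 1; exact hip n
      i_r := hir
      j_p := hjp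
      total := ht
      pull_id := hpull }
  refine ⟨A', C', ⟨S⟩, fun n hn => ⟨?_, ?_⟩, fun n hn => ?_, fun n hn => ?_⟩
  · change i n ≫ E.cx.d n (n + 1) ≫ r (n + 1) = 0
    rw [hn, zero_comp, comp_zero]
  · change j n ≫ E.cx.d n (n + 1) ≫ p (n + 1) = 0
    rw [hn, zero_comp, comp_zero]
  · exact (hA n hn).eq_of_src _ _
  · exact (hC _ hn).eq_of_tgt _ _

/-- Here the differential of the cone is (x, y) ↦ (0, x), so the cone is orthogonally split with A^n
= E^n. -/
lemma meager_cone_id_of_d_eq_zero (E : HermComplex s) (h : ∀ n, E.cx.d n (n + 1) = 0) :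
    Meager (cone (𝟙 E.cx)) := by
  refine .orthogonallySplit _ ⟨fun n => ⟨_, E.isVectorBundle n, E.metric n⟩, cSnd _, cFst _,
    fun n => ⟨⟨?_, fun x v w => ?_⟩, ?_, ?_⟩⟩
  · refine ⟨biprod.desc ((cInr (𝟙 E.cx)).f n) (cInl (𝟙 E.cx) n), ?_, ?_⟩
    · rw [biprod.lift_desc, add_comm]
      exact cone_total _ _
    · apply biprod.hom_ext <;> apply biprod.hom_ext' <;> simp
  · have := congrFun (congrFun (congrFun (pull_cone (𝟙 E.cx) n (𝟙 _)) x) v) w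
    rw [HermMetric.pull_id_apply, add_comm, Category.id_comp, Category.id_comp] at this
    exact this
  · rw [d_cSnd, h]; simp
  · rw [d_cFst, h]; simp

lemma meager_cone_id (E : HermComplex s) : Meager (cone (𝟙 E.cx)) := by
  -- Induction on the length m of an interval [a, a + m) outside which all differentials vanish.
  have key : ∀ (m : ℕ) (a : ℤ) (E : HermComplex s),
      (∀ n, n < a ∨ a + m ≤ n → E.cx.d n (n + 1) = 0) → Meager (cone (𝟙 E.cx)) := by
    intro m a
    induction m with
    | zero => exact fun E hE => meager_cone_id_of_d_eq_zero E fun n => hE n (by simp; lia)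
    | succ m ih =>
      intro E hE
      -- Cutting at the end of the interval kills the differential from degree a + m to a + m + 1: A
      -- then has zero differential, and C falls under the induction hypothesis.
      obtain ⟨A, C, ⟨S⟩, h, hA, hC⟩ := exists_orthExt_truncation E (a + m + 1)
      refine (S.coneOf S (𝟙 _) (𝟙 _) (𝟙 _) (by simp) (by simp)).meager_middle
        (meager_cone_id_of_d_eq_zero A fun n => ?_) (ih C fun n hn => ?_)
      · by_cases hn : n < a + m + 1
        · exact hA n hn
        · exact (h n (hE n (Or.inr (by push_cast; lia)))).1
      · rcases hn with hn | hn
        · exact (h n (hE n (Or.inl hn))).2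
        · exact hC n (by lia)
  obtain ⟨N, hN⟩ := E.bounded
  -- The interval is [-|N|, |N|]; absolute values are needed because the bound N may be negative.
  refine key (2 * |N| + 1).toNat (- |N|) E fun n hn => (hN n ?_).eq_of_src _ _
  rcases abs_cases n with h | h <;> rcases abs_cases N with h' | h' <;> lia

/-! ### Tight morphisms -/

lemma tight_id (E : HermComplex s) : Tight (𝟙 E.cx) := meager_cone_id E

/-- The cone of `S.i` is an extension of the cone of 0 ⟶ C by the cone of the identity of A. -/
lemma OrthExt.tight_i {A B C : HermComplex s} (S : OrthExt A B C) (hC : Meager C) :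
    Tight S.i :=
  ((ofIdLeft A).coneOf S (𝟙 _) S.i 0 (by simp [ofIdLeft]) (by simp [ofIdLeft])).meager_middle
    (meager_cone_id A) (.cone _ meager_zero hC)

/-- Dually, the cone of `S.p` is an extension of the cone of the identity of C by the cone of A ⟶ 0.
-/
lemma OrthExt.tight_p {A B C : HermComplex s} (S : OrthExt A B C) (hA : Meager A) :
    Tight S.p :=
  (S.coneOf (ofIdRight C) 0 S.p (𝟙 _) (by simp [ofIdRight]) (by simp [ofIdRight])).meager_middle
    (.cone _ hA meager_zero) (meager_cone_id C)

/-- An isometry, as an extension of `0`. -/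
def OrthExt.ofIsometry {E F : HermComplex s} (φ : E.cx ≅ F.cx) (h : IsIsometry E F φ) :
    OrthExt E F (zero s) where
  i := φ.hom
  p := 0
  r := φ.inv.f
  j _ := 0
  i_p := by simp
  i_r n := by rw [← HomologicalComplex.comp_f, φ.hom_inv_id, HomologicalComplex.id_f]
  j_p n := (isZero_zero_X n).eq_of_src _ _
  total n := by
    rw [← HomologicalComplex.comp_f, φ.inv_hom_id, HomologicalComplex.id_f, comp_zero, add_zero]
  pull_id n := by
    rw [HomologicalComplex.zero_f, HermMetric.pull_zero, add_zero]
    exact (h.symm n).symm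

lemma IsIsometry.tight {E F : HermComplex s} {φ : E.cx ≅ F.cx} (h : IsIsometry E F φ) :
    Tight φ.hom :=
  (OrthExt.ofIsometry φ h).tight_i meager_zero

/-- The extension computing the cone of `cone(f) ⟶ cone(g ∘ f)`. -/
def OrthExt.ofConeToConeComp {E F G : HermComplex s} (f : E.cx ⟶ F.cx) (g : F.cx ⟶ G.cx) :
    OrthExt (cone g) (cone (coneToConeComp f g)) (cone (𝟙 E.shift.cx)) :=
  (ofCone f).coneOf (ofCone (E := E) (F := G) (f ≫ g)) g (coneToConeComp f g) (𝟙 _)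
    (by
      change g ≫ cInr _ = cInr f ≫ cMap f (f ≫ g) (𝟙 _) g _
      ext n : 1
      apply cone_ext_to <;> simp)
    (by
      change cMap f (f ≫ g) (𝟙 _) g _ ≫ cToShift (f ≫ g) = cToShift f ≫ 𝟙 _
      ext n : 1
      apply shift_ext_to
      simp)

/-- The extension computing the cone of `cone(g ∘ f) ⟶ cone(g)`. -/
def OrthExt.ofConeCompToCone {E F G : HermComplex s} (f : E.cx ⟶ F.cx) (g : F.cx ⟶ G.cx) :
    OrthExt (cone (𝟙 G.cx)) (cone (coneCompToCone f g)) (cone (shiftMap f)) :=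
  (ofCone (E := E) (F := G) (f ≫ g)).coneOf (ofCone g) (𝟙 _) (coneCompToCone f g) (shiftMap f)
    (by
      change 𝟙 _ ≫ cInr _ = cInr (f ≫ g) ≫ cMap (f ≫ g) g f (𝟙 _) _
      ext n : 1
      apply cone_ext_to <;> simp)
    (by
      change cMap (f ≫ g) g f (𝟙 _) _ ≫ cToShift g = cToShift (f ≫ g) ≫ shiftMap f
      ext n : 1
      apply shift_ext_to
      simp)

/-- The cone of cone(f) ⟶ cone(g ∘ f) is an extension of the cone of an identity by cone(g), hence
meager; so cone(g ∘ f) is meager along with cone(f). -/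
lemma Tight.comp {E F G : HermComplex s} {f : E.cx ⟶ F.cx} {g : F.cx ⟶ G.cx} (hf : Tight f)
    (hg : Tight g) : Tight (E := E) (F := G) (f ≫ g) :=
  .target _ hf ((OrthExt.ofConeToConeComp f g).meager_middle hg (meager_cone_id _))

/-! ### Shifting and desuspending tight morphisms. -/

lemma isometric_cone_shiftMap {E F : HermComplex s} (f : E.cx ⟶ F.cx) :
    Isometric (cone (shiftMap f)) (cone f).shift := by
  -- The differentials are (dx, f(x) - dy) on cone(f[1]) and (dx, -f(x) - dy) on cone(f)[1]; the
  -- sign change on x intertwines them.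
  refine isometric_of_hom (homMk (fun n =>
      (-(cFst (shiftMap f) n ≫ E.ofShift (n + 1) ≫ cInl f (n + 1)) +
        cSnd (shiftMap f) n ≫ F.ofShift n ≫ (cInr f).f (n + 1)) ≫ (cone f).toShift n)
      fun n => ?_)
    (fun n => (cone f).ofShift n ≫ (-(cFst f (n + 1) ≫ E.toShift (n + 1) ≫ cInl _ n) +
      cSnd f (n + 1) ≫ F.toShift n ≫ (cInr _).f n))
    (fun n => ?_) (fun n => ?_) (fun n => ?_)
  · apply shift_ext_to
    apply cone_ext_to
    · simp [d_ofShift, d_ofShift_assoc, d_cFst, d_cFst_assoc, d_cSnd_assoc]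
    · simp [d_ofShift, d_ofShift_assoc, d_cFst_assoc, d_cSnd, d_cSnd_assoc]
  · apply cone_ext_to <;> simp
  · apply shift_ext_to
    apply cone_ext_to <;> simp
  · rw [pull_shift, pull_cone, pull_cone, pull_shift, pull_shift]
    simp

lemma tight_shiftMap_iff {E F : HermComplex s} (f : E.cx ⟶ F.cx) :
    Tight (shiftMap f) ↔ Tight f :=
  (meager_iff_of_isometric (isometric_cone_shiftMap f)).trans (meager_shift_iff _)

lemma pull_XIsoOfEq (E : HermComplex s) {m n : ℤ} (h : m = n) :
    (E.metric n).pull (E.cx.XIsoOfEq h).hom = (E.metric m).pull (𝟙 _) := by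
  subst h
  simp

lemma exists_isometric_shift (E : HermComplex s) : ∃ F : HermComplex s, Isometric F.shift E := by
  obtain ⟨N, hN⟩ := E.bounded
  let F : HermComplex s :=
    { cx := E.cx⟦(-1 : ℤ)⟧
      bounded := ⟨N + 1, fun n hn => hN (n + -1) (by
        rcases abs_cases n with h | h <;> rcases abs_cases (n + -1) with h' | h' <;> lia)⟩
      isVectorBundle := fun n => E.isVectorBundle (n + -1)
      metric := fun n => E.metric (n + -1) }
  have hn : ∀ n : ℤ, n + 1 + -1 = n := fun n => by lia
  have hd : ∀ n, F.shift.cx.d n (n + 1) = E.cx.d (n + 1 + -1) (n + 1 + 1 + -1) := fun n => by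
    have h1 : (F.cx⟦(1 : ℤ)⟧).d n (n + 1) = - F.cx.d (n + 1) (n + 1 + 1) := by simp
    have h2 : (E.cx⟦(-1 : ℤ)⟧).d (n + 1) (n + 1 + 1) =
        - E.cx.d (n + 1 + -1) (n + 1 + 1 + -1) := by simp
    exact h1.trans ((congrArg (- ·) h2).trans (neg_neg _))
  refine ⟨F, isometric_of_hom (homMk (fun n => (E.cx.XIsoOfEq (hn n)).hom) fun n => ?_)
    (fun n => (E.cx.XIsoOfEq (hn n)).inv) (fun n => ?_) (fun n => ?_) (fun n => ?_)⟩
  · rw [hd]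
    exact (E.cx.XIsoOfEq_hom_comp_d _ _).trans (E.cx.d_comp_XIsoOfEq_hom _ _).symm
  · exact (E.cx.XIsoOfEq (hn n)).hom_inv_id
  · exact (E.cx.XIsoOfEq (hn n)).inv_hom_id
  · exact E.pull_XIsoOfEq (hn n)

/-! ### Tightly related complexes -/

lemma Tight.tightlyRelated {E F : HermComplex s} {f : E.cx ⟶ F.cx} (h : Tight f) :
    TightlyRelated E F :=
  ⟨E, 𝟙 _, f, tight_id E, h⟩

lemma TightlyRelated.symm {E F : HermComplex s} (h : TightlyRelated E F) : TightlyRelated F E :=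
  let ⟨G, f, g, hf, hg⟩ := h
  ⟨G, g, f, hg, hf⟩

lemma Isometric.exists_tight {E F : HermComplex s} (h : Isometric E F) :
    ∃ f : E.cx ⟶ F.cx, Tight f :=
  let ⟨φ, h⟩ := isometric_iff.1 h
  ⟨φ.hom, h.tight⟩

/-- A direct sum as an extension of the first summand by the second. -/
def OrthExt.ofDsum' (E F : HermComplex s) : OrthExt F (E.dsum F) E where
  i := dInr E F
  p := dFst E F
  r := (dSnd E F).f
  j := (dInl E F).f
  i_p := by simp
  i_r n := by simp
  j_p n := by simp
  total n := by apply dsum_ext_to <;> simp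
  pull_id n := by rw [pull_dsum, add_comm]; simp

/-- Extending `w` to a morphism from `S` to the extension of 0 by F exhibits cone(w) as an extension
of cone(G ⟶ 0) = G[1] by the meager cone of `S.i ≫ w`. -/
lemma exists_tight_to_shift {A G F W : HermComplex s} (S : OrthExt A W G) (w : W.cx ⟶ F.cx)
    (h : Tight (S.i ≫ w)) : ∃ p : (cone w).cx ⟶ G.shift.cx, Tight p := by
  let S' := S.coneOf (.ofIdLeft F) (S.i ≫ w) w 0 (by simp [OrthExt.ofIdLeft])
    (by simp [OrthExt.ofIdLeft])
  obtain ⟨q, hq⟩ := (isometric_cone_to_zero (0 : G.cx ⟶ (zero s).cx)).exists_tight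
  exact ⟨S'.p ≫ q, (S'.tight_p h).comp hq⟩

/-- The apex is a homotopy fibre product: the desuspended cone of u + v on E ⊕ F. As v is tight,
that cone maps tightly to E[1]; as u is tight, it maps tightly to F[1]. -/
lemma Tight.exists_span {E F G : HermComplex s} {u : E.cx ⟶ G.cx} {v : F.cx ⟶ G.cx}
    (hu : Tight u) (hv : Tight v) :
    ∃ (P : HermComplex s) (f : P.cx ⟶ E.cx) (g : P.cx ⟶ F.cx), Tight f ∧ Tight g := by
  let w : (E.dsum F).cx ⟶ G.cx := dFst E F ≫ u + dSnd E F ≫ v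
  obtain ⟨p, hp⟩ := exists_tight_to_shift (.ofDsum' E F) w
    (by simpa [w, OrthExt.ofDsum'] using hv)
  obtain ⟨q, hq⟩ := exists_tight_to_shift (.ofDsum E F) w
    (by simpa [w, OrthExt.ofDsum] using hu)
  obtain ⟨P, hP⟩ := exists_isometric_shift (cone w)
  obtain ⟨i, hi⟩ := hP.exists_tight
  -- The shift functor is full, so morphisms from P[1] to E[1] and F[1] descend.
  obtain ⟨f, hf⟩ := (shiftFunctor (CochainComplex X.Modules ℤ) (1 : ℤ)).map_surjective
    (X := P.cx) (Y := E.cx) (i ≫ p)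
  obtain ⟨g, hg⟩ := (shiftFunctor (CochainComplex X.Modules ℤ) (1 : ℤ)).map_surjective
    (X := P.cx) (Y := F.cx) (i ≫ q)
  refine ⟨P, f, g, (tight_shiftMap_iff f).1 ?_, (tight_shiftMap_iff g).1 ?_⟩
  · rw [show shiftMap f = i ≫ p from hf]
    exact hi.comp hp
  · rw [show shiftMap g = i ≫ q from hg]
    exact hi.comp hq

lemma TightlyRelated.trans {E F G : HermComplex s} (h : TightlyRelated E F)
    (h' : TightlyRelated F G) : TightlyRelated E G := by
  obtain ⟨P, f, g, hf, hg⟩ := h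
  obtain ⟨Q, f', g', hf', hg'⟩ := h'
  obtain ⟨R, a, b, ha, hb⟩ := hg.exists_span hf'
  exact ⟨R, a ≫ f, b ≫ g', ha.comp hf, hb.comp hg'⟩

lemma tightlyRelated_equivalence : _root_.Equivalence (TightlyRelated (s := s)) where
  refl E := (tight_id E).tightlyRelated
  symm h := h.symm
  trans h h' := h.trans h'

lemma TightlyRelated.of_isometric {E F : HermComplex s} (h : Isometric E F) :
    TightlyRelated E F :=
  let ⟨_, h⟩ := h.exists_tight
  h.tightlyRelated

/-! ### Direct sums of morphisms -/

/-- The direct sum of two morphisms. -/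
def dsumMap {E E' F F' : HermComplex s} (f : E.cx ⟶ F.cx) (g : E'.cx ⟶ F'.cx) :
    (E.dsum E').cx ⟶ (F.dsum F').cx :=
  dFst _ _ ≫ f ≫ dInl _ _ + dSnd _ _ ≫ g ≫ dInr _ _

section

variable {E E' F F' : HermComplex s} (f : E.cx ⟶ F.cx) (g : E'.cx ⟶ F'.cx)

@[simp]
lemma dsumMap_fst : dsumMap f g ≫ dFst _ _ = dFst _ _ ≫ f := by simp [dsumMap]

@[simp]
lemma dsumMap_snd : dsumMap f g ≫ dSnd _ _ = dSnd _ _ ≫ g := by simp [dsumMap]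

@[simp]
lemma dInl_dsumMap : dInl _ _ ≫ dsumMap f g = f ≫ dInl _ _ := by simp [dsumMap]

@[simp]
lemma dInr_dsumMap : dInr _ _ ≫ dsumMap f g = g ≫ dInr _ _ := by simp [dsumMap]

lemma isometric_cone_dsumMap :
    Isometric (cone (dsumMap f g)) ((cone f).dsum (cone g)) := by
  refine isometric_of_hom
    (cMap _ f (dFst _ _) (dFst _ _) (dsumMap_fst f g) ≫ dInl _ _ +
      cMap _ g (dSnd _ _) (dSnd _ _) (dsumMap_snd f g) ≫ dInr _ _)
    (fun n => (dFst (cone f) (cone g) ≫ cMap f _ (dInl _ _) (dInl _ _) (dInl_dsumMap f g).symm +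
      dSnd _ _ ≫ cMap g _ (dInr _ _) (dInr _ _) (dInr_dsumMap f g).symm).f n)
    (fun n => ?_) (fun n => ?_) (fun n => ?_)
  · apply cone_ext_to <;> apply dsum_ext_to <;> simp
  · apply dsum_ext_to <;> apply cone_ext_to <;> simp
  · simp only [pull_dsum, pull_cone, HomologicalComplex.add_f_apply, HomologicalComplex.comp_f,
      Preadditive.add_comp, Category.assoc, dInl_fst_f, dInl_snd_f, dInr_fst_f, dInr_snd_f,
      cMap_fst, cMap_snd, Category.comp_id, Category.id_comp, comp_zero, add_zero, zero_add]
    abel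

end

lemma Meager.dsum {E F : HermComplex s} (hE : Meager E) (hF : Meager F) : Meager (E.dsum F) :=
  (OrthExt.ofDsum E F).meager_middle hE hF

lemma Tight.dsumMap {E E' F F' : HermComplex s} {f : E.cx ⟶ F.cx} {g : E'.cx ⟶ F'.cx}
    (hf : Tight f) (hg : Tight g) : Tight (dsumMap f g) :=
  (Meager.dsum hf hg).of_isometric (isometric_cone_dsumMap f g)

lemma TightlyRelated.dsum {E E' F F' : HermComplex s} (h : TightlyRelated E F)
    (h' : TightlyRelated E' F') : TightlyRelated (E.dsum E') (F.dsum F') :=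
  let ⟨G, _, _, hf, hg⟩ := h
  let ⟨G', _, _, hf', hg'⟩ := h'
  ⟨G.dsum G', _, _, hf.dsumMap hf', hg.dsumMap hg'⟩

lemma isometric_dsum_zero (E : HermComplex s) : Isometric (E.dsum (zero s)) E := by
  refine isometric_of_hom (dFst _ _) (fun n => (dInl E (zero s)).f n)
    (fun n => ?_) (fun n => ?_) (fun n => ?_)
  · apply dsum_ext_to
    · simp
    · exact (isZero_zero_X n).eq_of_tgt _ _
  · simp
  · rw [pull_dsum, (isZero_zero_X n).eq_of_tgt (𝟙 _ ≫ (dSnd E (zero s)).f n) 0]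
    simp

lemma isometric_shift_dsum (E F : HermComplex s) :
    Isometric (E.dsum F).shift (E.shift.dsum F.shift) := by
  refine isometric_of_hom (shiftMap (dFst E F) ≫ dInl _ _ + shiftMap (dSnd E F) ≫ dInr _ _)
    (fun n => (dFst _ _ ≫ shiftMap (dInl E F) + dSnd _ _ ≫ shiftMap (dInr E F)).f n)
    (fun n => ?_) (fun n => ?_) (fun n => ?_)
  · apply shift_ext_to
    apply dsum_ext_to <;> simp
  · apply dsum_ext_to <;> apply shift_ext_to <;> simp
  · simp [pull_dsum, pull_shift]

lemma TightlyRelated.shift {E F : HermComplex s} (h : TightlyRelated E F) :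
    TightlyRelated E.shift F.shift :=
  let ⟨G, f, g, hf, hg⟩ := h
  ⟨G.shift, shiftMap f, shiftMap g, (tight_shiftMap_iff f).2 hf, (tight_shiftMap_iff g).2 hg⟩

lemma exists_tight_of_shift {P E F : HermComplex s} (h : Isometric P.shift E)
    {f : E.cx ⟶ F.shift.cx} (hf : Tight f) : ∃ g : P.cx ⟶ F.cx, Tight g := by
  obtain ⟨i, hi⟩ := h.exists_tight
  obtain ⟨g, hg⟩ := (shiftFunctor (CochainComplex X.Modules ℤ) (1 : ℤ)).map_surjective
    (X := P.cx) (Y := F.cx) (i ≫ f)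
  refine ⟨g, (tight_shiftMap_iff g).1 ?_⟩
  rw [show shiftMap g = i ≫ f from hg]
  exact hi.comp hf

lemma TightlyRelated.of_shift {E F : HermComplex s} (h : TightlyRelated E.shift F.shift) :
    TightlyRelated E F := by
  obtain ⟨G, f, g, hf, hg⟩ := h
  obtain ⟨P, hP⟩ := exists_isometric_shift G
  obtain ⟨f', hf'⟩ := exists_tight_of_shift hP hf
  obtain ⟨g', hg'⟩ := exists_tight_of_shift hP hg
  exact ⟨P, f', g', hf', hg'⟩

/-! ### Squares commuting up to homotopy -/

section transpose

variable {E' F' E F : HermComplex s} {f' : E'.cx ⟶ F'.cx} {f : E.cx ⟶ F.cx}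
  {g' : E'.cx ⟶ E.cx} {g : F'.cx ⟶ F.cx} (h : Homotopy (f' ≫ g) (g' ≫ f))

/-- The identification of the total complex of a square with that of the transposed square. -/
def coneTranspose : (cone (coneMap h)).cx ⟶ (cone (coneMap (transposeHomotopy h))).cx :=
  homMk (fun n =>
      (cFst (coneMap h) n ≫ cFst f' (n + 1) ≫ cInl (-g') (n + 1) +
        cSnd (coneMap h) n ≫ cFst f n ≫ (cInr (-g')).f (n + 1)) ≫ cInl _ n +
      (cFst (coneMap h) n ≫ cSnd f' (n + 1) ≫ cInl g n +
        cSnd (coneMap h) n ≫ cSnd f n ≫ (cInr g).f n) ≫ (cInr _).f n) fun n => by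
    have ht : (transposeHomotopy h).hom = h.hom := rfl
    apply cone_ext_to <;> apply cone_ext_to
    · simp [d_cFst, d_cFst_assoc]
    · simp [d_cFst, d_cSnd, d_cFst_assoc, d_cSnd_assoc]
    · simp [d_cFst, d_cFst_assoc, d_cSnd_assoc]
      exact add_comm _ _
    · simp [d_cSnd, d_cFst_assoc, d_cSnd_assoc, ht]
      abel

lemma coneTranspose_fst (n : ℤ) : (coneTranspose h).f n ≫ cFst _ n =
    cFst (coneMap h) n ≫ cFst f' (n + 1) ≫ cInl (-g') (n + 1) +
      cSnd (coneMap h) n ≫ cFst f n ≫ (cInr (-g')).f (n + 1) := by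
  simp [coneTranspose]

lemma coneTranspose_snd (n : ℤ) : (coneTranspose h).f n ≫ cSnd _ n =
    cFst (coneMap h) n ≫ cSnd f' (n + 1) ≫ cInl g n +
      cSnd (coneMap h) n ≫ cSnd f n ≫ (cInr g).f n := by
  simp [coneTranspose]

/-- In degree n both sides are sums of E'^{n+2}, F'^{n+1}, E^{n+1} and F^n, and the isometry
exchanges the two middle summands. No signs are needed because the transposed square already carries
-g' and -f'. -/
lemma isometric_cone_coneMap_transpose :
    Isometric (cone (coneMap h)) (cone (coneMap (transposeHomotopy h))) := by
  refine isometric_of_hom (coneTranspose h)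
    (fun n => (cFst (coneMap (transposeHomotopy h)) n ≫ cFst (-g') (n + 1) ≫ cInl f' (n + 1) +
        cSnd _ n ≫ cFst g n ≫ (cInr f').f (n + 1)) ≫ cInl _ n +
      (cFst _ n ≫ cSnd (-g') (n + 1) ≫ cInl f n +
        cSnd _ n ≫ cSnd g n ≫ (cInr f).f n) ≫ (cInr _).f n)
    (fun n => ?_) (fun n => ?_) (fun n => ?_)
  · apply cone_ext_to <;> apply cone_ext_to <;>
      simp [reassoc_of% (coneTranspose_fst h), reassoc_of% (coneTranspose_snd h)]
  · apply cone_ext_to <;> apply cone_ext_to <;> simp [coneTranspose_fst, coneTranspose_snd]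
  · simp only [pull_cone, coneTranspose_fst, coneTranspose_snd, Category.assoc,
      Preadditive.add_comp, cInl_fst, cInr_fst, cInl_snd, cInr_snd, comp_zero, add_zero,
      zero_add, Category.comp_id, Category.id_comp]
    abel

end transpose

end HermComplex

/-! ### Classes -/

lemma cls_eq_iff {E F : HermComplex s} : cls E = cls F ↔ TightlyRelated E F :=
  tightlyRelated_equivalence.quot_mk_eq_iff E F

lemma cls_eq_of_isometric {E F : HermComplex s} (h : Isometric E F) : cls E = cls F :=
  cls_eq_iff.2 (.of_isometric h)

lemma HermComplex.Tight.cls_eq {E F : HermComplex s} {f : E.cx ⟶ F.cx}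
    (h : Tight f) : cls E = cls F :=
  cls_eq_iff.2 h.tightlyRelated

/-- Classes form a commutative monoid under the orthogonal direct sum. -/
abbrev addCommMonoidTightClass : AddCommMonoid (TightClass s) where
  add := Quot.map₂ HermComplex.dsum
    (fun E _ _ h => (tightlyRelated_equivalence.refl E).dsum h)
    (fun _ _ E h => h.dsum (tightlyRelated_equivalence.refl E))
  zero := cls (zero s)
  add_assoc := by
    rintro ⟨E⟩ ⟨F⟩ ⟨G⟩
    exact cls_eq_of_isometric (isometric_dsum_assoc E F G)
  zero_add := by
    rintro ⟨E⟩
    exact cls_eq_of_isometric ((isometric_dsum_comm _ _).trans (isometric_dsum_zero E))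
  add_zero := by
    rintro ⟨E⟩
    exact cls_eq_of_isometric (isometric_dsum_zero E)
  add_comm := by
    rintro ⟨E⟩ ⟨F⟩
    exact cls_eq_of_isometric (isometric_dsum_comm E F)
  nsmul := @nsmulRec _ ⟨cls (zero s)⟩ ⟨Quot.map₂ HermComplex.dsum
    (fun E _ _ h => (tightlyRelated_equivalence.refl E).dsum h)
    (fun _ _ E h => h.dsum (tightlyRelated_equivalence.refl E))⟩
  nsmul_zero _ := rfl
  nsmul_succ _ _ := rfl

attribute [local instance] addCommMonoidTightClass

lemma cls_dsum (E F : HermComplex s) : cls (E.dsum F) = cls E + cls F := rfl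

lemma cls_zero : cls (zero s) = 0 := rfl

lemma cls_eq_zero_iff (E : HermComplex s) : cls E = 0 ↔ Meager E := by
  rw [← cls_zero, cls_eq_iff]
  constructor
  · rintro ⟨G, f, g, hf, hg⟩
    exact .target f (.source g meager_zero hg) hf
  · intro h
    exact Tight.tightlyRelated (f := (0 : E.cx ⟶ (zero s).cx)) (.cone _ h meager_zero)

lemma cls_shift_inj {E F : HermComplex s} : cls E.shift = cls F.shift ↔ cls E = cls F := by
  rw [cls_eq_iff, cls_eq_iff]
  exact ⟨TightlyRelated.of_shift, TightlyRelated.shift⟩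

lemma cls_shift_dsum (E F : HermComplex s) :
    cls (E.dsum F).shift = cls E.shift + cls F.shift :=
  cls_eq_of_isometric (isometric_shift_dsum E F)

/-! ### Inverses, and cones with acyclic source or target. -/

lemma meager_dsum_shift {E : HermComplex s} (hE : E.cx.Acyclic) : Meager (E.dsum E.shift) :=
  .dsumShift _ E hE (.refl _)

lemma cls_add_shift {E : HermComplex s} (hE : E.cx.Acyclic) : cls E + cls E.shift = 0 :=
  (cls_eq_zero_iff _).2 (meager_dsum_shift hE)

/-- Both classes are inverse to that of E[1], and inverses in a monoid are unique. -/
lemma cls_shift_shift {E : HermComplex s} (hE : E.cx.Acyclic) : cls E.shift.shift = cls E := by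
  rw [← add_zero (cls E), ← cls_add_shift (acyclic_shift hE), ← add_assoc, cls_add_shift hE,
    zero_add]

lemma exists_cls_add_eq_zero_iff (E : HermComplex s) :
    (∃ F : HermComplex s, cls F + cls E = 0) ↔ E.cx.Acyclic := by
  constructor
  · rintro ⟨F, h⟩
    exact acyclic_of_retract _ _ (dInr_snd F E) ((cls_eq_zero_iff (F.dsum E)).1 h).acyclic
  · exact fun h => ⟨E.shift, (add_comm _ _).trans (cls_add_shift h)⟩

/-- If the source is meager, the cone has the class of the target. -/
lemma cls_cone_of_meager_source {E F : HermComplex s} (f : E.cx ⟶ F.cx) (hE : Meager E) :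
    cls (cone f) = cls F :=
  ((OrthExt.ofCone f).tight_i ((meager_shift_iff E).2 hE)).cls_eq.symm

/-- If the target is meager, the cone has the class of the shifted source. -/
lemma cls_cone_of_meager_target {E F : HermComplex s} (f : E.cx ⟶ F.cx) (hF : Meager F) :
    cls (cone f) = cls E.shift :=
  ((OrthExt.ofCone f).tight_p hF).cls_eq

lemma cls_cone_dsumMap {E E' F F' : HermComplex s} (f : E.cx ⟶ F.cx) (g : E'.cx ⟶ F'.cx) :
    cls (cone (dsumMap f g)) = cls (cone f) + cls (cone g) :=
  cls_eq_of_isometric (isometric_cone_dsumMap f g)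

/-- Consider f ⊕ 0 : E ⊕ E[1] ⟶ F ⊕ 0. Its source is meager, so its cone has class [F]; this cone is
also cone(f) ⊕ E[2] up to isometry, and [E[2]] = [E]. -/
lemma cls_cone_add_of_acyclic_source {E F : HermComplex s} (f : E.cx ⟶ F.cx)
    (hE : E.cx.Acyclic) : cls (cone f) + cls E = cls F := by
  have h := cls_cone_dsumMap f (0 : E.shift.cx ⟶ (zero s).cx)
  rw [cls_cone_of_meager_source _ (meager_dsum_shift hE),
    cls_cone_of_meager_target _ meager_zero, cls_dsum, cls_zero, add_zero,
    cls_shift_shift hE] at h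
  exact h.symm

/-- Consider f ⊕ 0 : E ⊕ 0 ⟶ F ⊕ F[1]. Its target is meager, so [E[1]] = [cone(f)] + [F[1]]; adding
[F] cancels [F[1]]. -/
lemma cls_cone_of_acyclic_target {E F : HermComplex s} (f : E.cx ⟶ F.cx)
    (hF : F.cx.Acyclic) : cls (cone f) = cls F + cls E.shift := by
  have h := cls_cone_dsumMap f (0 : (zero s).cx ⟶ F.shift.cx)
  rw [cls_cone_of_meager_target _ (meager_dsum_shift hF),
    cls_cone_of_meager_source _ meager_zero, cls_shift_inj.2 (cls_eq_of_isometric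
      (isometric_dsum_zero E))] at h
  rw [h, add_left_comm, cls_add_shift hF, add_zero]

lemma exists_addUnits_cls {E : HermComplex s} (hE : E.cx.Acyclic) :
    ∃ u : AddUnits (TightClass s), (u : TightClass s) = cls E ∧
      ((-u : AddUnits (TightClass s)) : TightClass s) = cls E.shift :=
  ⟨⟨cls E, cls E.shift, cls_add_shift hE, (add_comm _ _).trans (cls_add_shift hE)⟩, rfl, rfl⟩

lemma cls_cone_of_acyclic_source {E F : HermComplex s} (f : E.cx ⟶ F.cx) (hE : E.cx.Acyclic)
    (u : AddUnits (TightClass s)) (hu : (u : TightClass s) = cls E) :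
    cls (cone f) = cls F + ((-u : AddUnits (TightClass s)) : TightClass s) := by
  rw [← cls_cone_add_of_acyclic_source f hE, ← hu, add_assoc, AddUnits.add_neg, add_zero]

/-! ### Compositions -/

section comp

variable {E F G : HermComplex s} (f : E.cx ⟶ F.cx) (g : F.cx ⟶ G.cx)

/-- This iterated cone is an extension of cone(f[1]) by the meager cone of the identity of G, so its
projection is tight. -/
lemma cls_cone_coneCompToCone : cls (cone (coneCompToCone f g)) = cls (cone f).shift :=
  ((OrthExt.ofConeCompToCone f g).tight_p (meager_cone_id G)).cls_eq.trans
    (cls_eq_of_isometric (isometric_cone_shiftMap f))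

lemma cls_cone_coneToConeComp : cls (cone (coneToConeComp f g)) = cls (cone g) :=
  ((OrthExt.ofConeToConeComp f g).tight_i (meager_cone_id E.shift)).cls_eq.symm

lemma cls_cone_comp_of_quasiIso (h : QuasiIso f ∨ QuasiIso g) :
    cls (cone (E := E) (F := G) (f ≫ g)) = cls (cone g) + cls (cone f) := by
  rw [← acyclic_cone_iff, ← acyclic_cone_iff] at h
  rcases h with h | h
  -- If cone(f) is acyclic, it is the source of cone(f) ⟶ cone(g ∘ f), whose cone has class
  -- [cone(g)].
  · rw [← cls_cone_coneToConeComp f g, cls_cone_add_of_acyclic_source _ h]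
  -- If cone(g) is acyclic, it is the target of cone(g ∘ f) ⟶ cone(g). That formula involves the
  -- shift of cone(g ∘ f), which need not be acyclic, so the identity is proved after shifting and
  -- recovered by injectivity of the shift on classes.
  · rw [← cls_dsum, ← cls_shift_inj, cls_shift_dsum, ← cls_cone_coneCompToCone f g,
      cls_cone_of_acyclic_target _ h, ← add_assoc, add_comm (cls (cone g).shift),
      cls_add_shift h, zero_add]

lemma cls_cone_of_quasiIso_comp (h : QuasiIso (f ≫ g)) :
    cls (cone g) = cls (cone f).shift + cls (cone (E := E) (F := G) (f ≫ g)) := by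
  rw [← cls_cone_coneToConeComp f g, cls_cone_of_acyclic_target _ ((acyclic_cone_iff _).2 h),
    add_comm]

end comp

end AcyclicCalculus

end

theorem mainTheorem2 {X : Scheme.{0}} (s : X ⟶ Spec (.of ℂ))
    [Smooth s] [IsSeparated s] [QuasiCompact s] :
    -- being tightly related is an equivalence relation
    _root_.Equivalence (TightlyRelated (s := s)) ∧
    -- direct sum induces an abelian semigroup structure on the classes, with zero `[0]`
    ∃ _ : AddCommMonoid (TightClass s),
      (∀ E F : HermComplex s, cls (E.dsum F) = cls E + cls F) ∧
      cls (HermComplex.zero s) = 0 ∧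
      -- a class is zero iff the complex is meager
      (∀ E : HermComplex s, cls E = 0 ↔ Meager E) ∧
      -- a class is invertible iff the complex is acyclic, and then `[E[1]] = -[E]`
      (∀ E : HermComplex s, (∃ F : HermComplex s, cls F + cls E = 0) ↔ E.cx.Acyclic) ∧
      (∀ E : HermComplex s, E.cx.Acyclic →
        ∃ u : AddUnits (TightClass s),
          (u : TightClass s) = cls E ∧ ((-u : AddUnits (TightClass s)) : TightClass s) =
            cls E.shift) ∧
      -- cones of morphisms with acyclic source: `[cone(f)] = [F] - [E]`
      (∀ (E F : HermComplex s) (f : E.cx ⟶ F.cx), E.cx.Acyclic →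
        ∀ u : AddUnits (TightClass s), (u : TightClass s) = cls E →
          cls (cone f) = cls F + ((-u : AddUnits (TightClass s)) : TightClass s)) ∧
      -- cones of morphisms with acyclic target: `[cone(f)] = [F] + [E[1]]`
      (∀ (E F : HermComplex s) (f : E.cx ⟶ F.cx), F.cx.Acyclic →
        cls (cone f) = cls F + cls E.shift) ∧
      -- squares that commute up to homotopy, for every choice of the homotopy
      (∀ (E' F' E F : HermComplex s) (f' : E'.cx ⟶ F'.cx) (f : E.cx ⟶ F.cx)
        (g' : E'.cx ⟶ E.cx) (g : F'.cx ⟶ F.cx) (h : Homotopy (f' ≫ g) (g' ≫ f)),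
        cls (cone (coneMap h)) = cls (cone (coneMap (transposeHomotopy h)))) ∧
      -- compositions
      (∀ (E F G : HermComplex s) (f : E.cx ⟶ F.cx) (g : F.cx ⟶ G.cx),
        cls (cone (coneCompToCone f g)) = cls (cone f).shift ∧
        cls (cone (coneToConeComp f g)) = cls (cone g) ∧
        ((QuasiIso f ∨ QuasiIso g) →
          cls (cone (E := E) (F := G) (f ≫ g)) = cls (cone g) + cls (cone f)) ∧
        (QuasiIso (f ≫ g) →
          cls (cone g) = cls (cone f).shift + cls (cone (E := E) (F := G) (f ≫ g)))) := by
  refine ⟨tightlyRelated_equivalence, addCommMonoidTightClass, cls_dsum, cls_zero, cls_eq_zero_iff,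
    exists_cls_add_eq_zero_iff, fun _ hE => exists_addUnits_cls hE,
    fun E F f hE u hu => cls_cone_of_acyclic_source f hE u hu,
    fun E F f hF => cls_cone_of_acyclic_target f hF,
    fun E' F' E F f' f g' g h => cls_eq_of_isometric (isometric_cone_coneMap_transpose h),
    fun E F G f g => ⟨cls_cone_coneCompToCone f g, cls_cone_coneToConeComp f g,
      cls_cone_comp_of_quasiIso f g, cls_cone_of_quasiIso_comp f g⟩⟩
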